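/- **Conventions.** Let $K$ be a commutative ring (for instance a field). Algebras are associative unital $K$-algebras, and an $(A,B)$-bimodule is a left $A$-, right $B$-module with commuting actions that induce the same action of $K$. Let $\mathcal A$ be a class of two-sided noetherian $K$-algebras such that $A\in\mathcal A$ if and only if $A^{\mathrm{op}}\in\mathcal A$. Let $\partial$ assign to every left and every right module $M$ over an algebra in $\mathcal A$ a value $\partial(M)\in\mathbb R_{\ge 0}\cup\{\pm\infty\}$ depending only on the isomorphism class of $M$, and write $\partial(A):=\partial(A_A)$. **Hypothesis (H).** For all $A,B\in\mathcal A$: 1. $\partial$ is an exact dimension function on left and on right $A$-modules: $\partial(M)=-\infty$ if and only if $M=0$; $\partial(M)=\max\{\partial(N),\partial(M/N)\}$ for every submodule $N\subseteq M$; and $\partial(\bigcup_i M_i)=\sup_i\partial(M_i)$ for every directed system of submodules $M_i$ of $M$. 2. $\partial(A)\in\mathbb N$. 3. For every $(A,B)$-bimodule $M$: if $M_B$ is finitely generated then $\partial({}_AM)\le\partial(M_B)$, and if ${}_AM$ is finitely generated then $\partial(M_B)\le\partial({}_AM)$. 4. If $\partial(A)=\partial(B)=d$, then $\gamma_{d-2,1}(A,B)$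 holds: for every $(A,B)$-bimodule $M$ that is finitely generated on both sides and $j=0,1$, $\mathrm{Tor}^A_j(N,M)$ is a finitely generated right $B$-module of dimension $\le d-2$ for every finitely generated right $A$-module $N$ with $\partial(N)\le d-2$, and $\mathrm{Tor}^B_j(M,N)$ is a finitely generated left $A$-module of dimension $\le d-2$ for every finitely generated left $B$-module $N$ with $\partial(N)\le d-2$. **Definitions.** Two $(D,A)$-bimodules $X,Y$ are *$n$-isomorphic*, $X\cong_n Y$, if there are a $(D,A)$-bimodule $P$ and bimodule maps $X\to P$ and $Y\to P$ whose kernels and cokernels, as right $A$-modules, have dimension $\le n$. (If $n<0$ this means that they are zero.) The grade of an $A$-module $M$ is $j(M)=\inf\{i:\mathrm{Ext}^i_A(M,A)\ne0\}\in\mathbb N\cup\{\infty\}$. An algebra $B$ is *Auslander regular* if $\operatorname{gldim}B<\infty$ and, for every finitely generated left or right $B$-module $M$ and every $q\ge0$, every $B$-submodule $N$ of $\mathrm{Ext}^q_B(M,B)$ has $j(N)\ge q$. It is *$\partial$-Cohen–Macaulay* if $\partial(B)\in\mathbb N$ and $j(M)+\partial(M)=\partial(B)$ for every nonzero finitely generated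 left or right $B$-module $M$. Let $A\in\mathcal A$ and $d=\partial(A)$. A *noncommutative quasi-resolution* (NQR) of $A$ is a triple $(B,{}_BM_A,{}_AN_B)$ in which $B\in\mathcal A$ is Auslander regular and $\partial$-Cohen–Macaulay with $\partial(B)=d$, and $M,N$ are bimodules, finitely generated on both sides, such that $$M\otimes_AN\cong_{d-2}B\quad\text{and}\quad N\otimes_BM\cong_{d-2}A$$ as bimodules. **Theorem 4.2.** Assume (H). Let $A\in\mathcal A$ with $\partial(A)\le 2$, and let $(B_1,M_1,N_1)$ and $(B_2,M_2,N_2)$ be two NQRs of $A$. Then $B_1$ and $B_2$ are Morita equivalent, that is, their module categories are equivalent as $K$-linear categories. -/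

import Mathlib

open CategoryTheory MulOpposite
open scoped TensorProduct

universe v u

/-! Conventions. A left `A`-module is a `Module A M`; a right `A`-module is a `Module Aᵐᵒᵖ M`, with
`x · a` written `op a • x`. An algebra is regarded as a right module over itself through Mathlib's
instance `Module Aᵐᵒᵖ A`. All algebras, modules and bimodules are over a commutative base ring `K`
(the base field, or a commutative algebra over it if bimodules are to be central over that algebra). -/

/-! ### The balanced tensor product over a noncommutative ring -/

section BalancedTensor

variable (A : Type u) [Ring A]

/-- The subgroup of `M ⊗[ℤ] N` generated by the elements `x · a ⊗ y - x ⊗ a • y`. -/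
def balancedRelations (M N : Type u) [AddCommGroup M] [Module Aᵐᵒᵖ M] [AddCommGroup N]
    [Module A N] : AddSubgroup (M ⊗[ℤ] N) :=
  AddSubgroup.closure {t | ∃ (x : M) (a : A) (y : N), t = (op a • x) ⊗ₜ[ℤ] y - x ⊗ₜ[ℤ] (a • y)}

/-- The tensor product `M ⊗_A N` of a right `A`-module `M` and a left `A`-module `N`. -/
def BalancedTensor (M N : Type u) [AddCommGroup M] [Module Aᵐᵒᵖ M] [AddCommGroup N]
    [Module A N] : Type u :=
  (M ⊗[ℤ] N) ⧸ balancedRelations A M N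

namespace BalancedTensor

variable {M M' M'' N N' N'' : Type u}
  [AddCommGroup M] [Module Aᵐᵒᵖ M] [AddCommGroup M'] [Module Aᵐᵒᵖ M']
  [AddCommGroup M''] [Module Aᵐᵒᵖ M'']
  [AddCommGroup N] [Module A N] [AddCommGroup N'] [Module A N'] [AddCommGroup N''] [Module A N'']

noncomputable instance : AddCommGroup (BalancedTensor A M N) :=
  inferInstanceAs (AddCommGroup ((M ⊗[ℤ] N) ⧸ balancedRelations A M N))

/-- The class of `x ⊗ y` in `M ⊗_A N`. -/
def tmul (x : M) (y : N) : BalancedTensor A M N :=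
  QuotientAddGroup.mk' (balancedRelations A M N) (x ⊗ₜ[ℤ] y)

theorem smul_tmul (x : M) (a : A) (y : N) : tmul A (op a • x) y = tmul A x (a • y) := by
  refine (QuotientAddGroup.eq_iff_sub_mem).2 ?_
  exact AddSubgroup.subset_closure ⟨x, a, y, rfl⟩

theorem induction {p : BalancedTensor A M N → Prop} (zero : p 0)
    (tmul : ∀ x y, p (tmul A x y)) (add : ∀ s t, p s → p t → p (s + t)) (t) : p t := by
  obtain ⟨t, rfl⟩ := QuotientAddGroup.mk'_surjective (balancedRelations A M N) t
  induction t using TensorProduct.induction_on with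
  | zero => rw [map_zero]; exact zero
  | tmul x y => exact tmul x y
  | add s t hs ht => rw [map_add]; exact add _ _ hs ht

theorem hom_ext {G : Type*} [AddCommGroup G] {φ ψ : BalancedTensor A M N →+ G}
    (h : ∀ x y, φ (tmul A x y) = ψ (tmul A x y)) : φ = ψ := by
  ext t
  refine induction A (p := fun t => φ t = ψ t) ?_ h ?_ t
  · simp
  · intro s t hs ht; simp [hs, ht]

/-- The map `f ⊗_A g` induced by a right `A`-linear `f` and a left `A`-linear `g`. -/
noncomputable def map (f : M →ₗ[Aᵐᵒᵖ] M') (g : N →ₗ[A] N') :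
    BalancedTensor A M N →+ BalancedTensor A M' N' :=
  QuotientAddGroup.map _ _
    (TensorProduct.map f.toAddMonoidHom.toIntLinearMap g.toAddMonoidHom.toIntLinearMap).toAddMonoidHom
    (by
      refine (AddSubgroup.closure_le _).2 ?_
      rintro _ ⟨x, a, y, rfl⟩
      refine AddSubgroup.subset_closure ⟨f x, a, g y, ?_⟩
      simp)

@[simp]
theorem map_tmul (f : M →ₗ[Aᵐᵒᵖ] M') (g : N →ₗ[A] N') (x : M) (y : N) :
    map A f g (tmul A x y) = tmul A (f x) (g y) := rfl

theorem tmul_add (x : M) (y y' : N) : tmul A x (y + y') = tmul A x y + tmul A x y' := by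
  simp only [tmul, TensorProduct.tmul_add, map_add]; rfl

theorem add_tmul (x x' : M) (y : N) : tmul A (x + x') y = tmul A x y + tmul A x' y := by
  simp only [tmul, TensorProduct.add_tmul, map_add]; rfl

theorem tmul_zero (x : M) : tmul A x (0 : N) = 0 := by
  simp only [tmul, TensorProduct.tmul_zero, map_zero]; rfl

theorem zero_tmul (y : N) : tmul A (0 : M) y = 0 := by
  simp only [tmul, TensorProduct.zero_tmul, map_zero]; rfl

theorem map_id : map A (LinearMap.id : M →ₗ[Aᵐᵒᵖ] M) (LinearMap.id : N →ₗ[A] N) =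
    AddMonoidHom.id _ :=
  hom_ext A fun _ _ => rfl

theorem map_comp (f' : M' →ₗ[Aᵐᵒᵖ] M'') (f : M →ₗ[Aᵐᵒᵖ] M') (g' : N' →ₗ[A] N'')
    (g : N →ₗ[A] N') :
    map A (f' ∘ₗ f) (g' ∘ₗ g) = (map A f' g').comp (map A f g) :=
  hom_ext A fun _ _ => rfl

theorem map_add_left (f f' : M →ₗ[Aᵐᵒᵖ] M') (g : N →ₗ[A] N') :
    map A (f + f') g = map A f g + map A f' g :=
  hom_ext A fun x y => add_tmul A (f x) (f' x) (g y)

theorem map_add_right (f : M →ₗ[Aᵐᵒᵖ] M') (g g' : N →ₗ[A] N') :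
    map A f (g + g') = map A f g + map A f g' :=
  hom_ext A fun x y => tmul_add A (f x) (g y) (g' y)

/-- Right `A`-linear endomorphisms of `M` act on `M ⊗_A N`. -/
noncomputable def leftEnd : Module.End Aᵐᵒᵖ M →+* AddMonoid.End (BalancedTensor A M N) where
  toFun f := map A f LinearMap.id
  map_one' := hom_ext A fun _ _ => rfl
  map_mul' _ _ := hom_ext A fun _ _ => rfl
  map_zero' := hom_ext A fun _ y => zero_tmul A y
  map_add' f g := hom_ext A fun x y => add_tmul A (f x) (g x) y

/-- Left `A`-linear endomorphisms of `N` act on `M ⊗_A N`. -/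
noncomputable def rightEnd : Module.End A N →+* AddMonoid.End (BalancedTensor A M N) where
  toFun g := map A LinearMap.id g
  map_one' := hom_ext A fun _ _ => rfl
  map_mul' _ _ := hom_ext A fun _ _ => rfl
  map_zero' := hom_ext A fun x _ => tmul_zero A x
  map_add' f g := hom_ext A fun x y => tmul_add A x (f y) (g y)

/-- If `S` acts on `M` compatibly with the right `A`-action, it acts on `M ⊗_A N` by
`s • (x ⊗ y) = (s • x) ⊗ y`. -/
@[reducible]
noncomputable def leftModule (S : Type*) [Ring S] [Module S M] [SMulCommClass S Aᵐᵒᵖ M] :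
    Module S (BalancedTensor A M N) :=
  Module.compHom _ ((leftEnd A (M := M) (N := N)).comp (Module.toModuleEnd Aᵐᵒᵖ (S := S) M))

/-- If `S` acts on `N` compatibly with the left `A`-action, it acts on `M ⊗_A N` by
`s • (x ⊗ y) = x ⊗ (s • y)`. -/
@[reducible]
noncomputable def rightModule (S : Type*) [Ring S] [Module S N] [SMulCommClass S A N] :
    Module S (BalancedTensor A M N) :=
  Module.compHom _ ((rightEnd A (M := M) (N := N)).comp (Module.toModuleEnd A (S := S) N))

end BalancedTensor

end BalancedTensor

/-! ### Bimodules -/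

/-- A `K`-central `(A, B)`-bimodule: a left `A`-module and a right `B`-module whose actions commute
and induce the same action of the base ring `K`. -/
structure CentralBimodule (K : Type v) [CommRing K] (A B : Type u) [Ring A] [Algebra K A] [Ring B]
    [Algebra K B] where
  /-- The underlying type. -/
  carrier : Type u
  [addCommGroup : AddCommGroup carrier]
  [moduleBase : Module K carrier]
  [moduleLeft : Module A carrier]
  [moduleRight : Module Bᵐᵒᵖ carrier]
  [smulComm : SMulCommClass A Bᵐᵒᵖ carrier]
  [towerLeft : IsScalarTower K A carrier]
  [towerRight : IsScalarTower K Bᵐᵒᵖ carrier]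

namespace CentralBimodule

variable {K : Type v} [CommRing K] {A B C : Type u} [Ring A] [Algebra K A] [Ring B] [Algebra K B]
  [Ring C] [Algebra K C]

instance : CoeSort (CentralBimodule K A B) (Type u) := ⟨carrier⟩

attribute [instance] addCommGroup moduleBase moduleLeft moduleRight smulComm towerLeft towerRight

instance (M : CentralBimodule K A B) : SMulCommClass Bᵐᵒᵖ A M := SMulCommClass.symm _ _ _

/-- Finitely generated on both sides. -/
def IsFG (M : CentralBimodule K A B) : Prop := Module.Finite A M ∧ Module.Finite Bᵐᵒᵖ M

/-- The algebra `A` as an `(A, A)`-bimodule. -/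
def regular (K : Type v) [CommRing K] (A : Type u) [Ring A] [Algebra K A] :
    CentralBimodule K A A where
  carrier := A

/-- The tensor product `M ⊗_B N` of an `(A, B)`-bimodule and a `(B, C)`-bimodule,
an `(A, C)`-bimodule. -/
noncomputable def tensor (M : CentralBimodule K A B) (N : CentralBimodule K B C) :
    CentralBimodule K A C :=
  letI : SMulCommClass K Bᵐᵒᵖ M := IsScalarTower.to_smulCommClass
  letI : Module K (BalancedTensor B M N) := BalancedTensor.leftModule B K
  letI : Module A (BalancedTensor B M N) := BalancedTensor.leftModule B A
  letI : Module Cᵐᵒᵖ (BalancedTensor B M N) := BalancedTensor.rightModule B Cᵐᵒᵖ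
  { carrier := BalancedTensor B M N
    smulComm := ⟨fun a c t => by
      refine BalancedTensor.induction B (p := fun t => a • c • t = c • a • t) ?_ ?_ ?_ t
      · simp
      · intro x y; rfl
      · intro s t hs ht; simp only [smul_add, hs, ht]⟩
    towerLeft := ⟨fun k a t => by
      refine BalancedTensor.induction B (p := fun t => (k • a) • t = k • a • t) ?_ ?_ ?_ t
      · simp
      · intro x y
        exact congrArg (fun z => BalancedTensor.tmul B z y) (smul_assoc k a x)
      · intro s t hs ht; simp only [smul_add, hs, ht]⟩
    towerRight := ⟨fun k c t => by
      refine BalancedTensor.induction B (p := fun t => (k • c) • t = k • c • t) ?_ ?_ ?_ t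
      · simp
      · intro x y
        change BalancedTensor.tmul B x ((k • c) • y) = BalancedTensor.tmul B (k • x) (c • y)
        have h : k • x = op (algebraMap K B k) • x := by
          rw [← MulOpposite.algebraMap_apply, algebraMap_smul]
        rw [h, BalancedTensor.smul_tmul, algebraMap_smul, smul_assoc]
      · intro s t hs ht; simp only [smul_add, hs, ht]⟩ }

/-- `N ⊗_A M` as a right `B`-module, for a right `A`-module `N` and an `(A, B)`-bimodule `M`. -/
noncomputable def tensorRightObj (M : CentralBimodule K A B) (N : ModuleCat.{u} Aᵐᵒᵖ) :
    ModuleCat.{u} Bᵐᵒᵖ :=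
  letI : Module Bᵐᵒᵖ (BalancedTensor A N M) := BalancedTensor.rightModule A Bᵐᵒᵖ
  ModuleCat.of Bᵐᵒᵖ (BalancedTensor A N M)

/-- The right `B`-linear map `f ⊗_A M`. -/
noncomputable def tensorRightMap (M : CentralBimodule K A B) {N N' : ModuleCat.{u} Aᵐᵒᵖ}
    (f : N ⟶ N') : tensorRightObj M N ⟶ tensorRightObj M N' :=
  letI : Module Bᵐᵒᵖ (BalancedTensor A N M) := BalancedTensor.rightModule A Bᵐᵒᵖ
  letI : Module Bᵐᵒᵖ (BalancedTensor A N' M) := BalancedTensor.rightModule A Bᵐᵒᵖ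
  ModuleCat.ofHom
    { toFun := BalancedTensor.map A f.hom LinearMap.id
      map_add' := map_add _
      map_smul' := fun b t => by
        refine BalancedTensor.induction A (p := fun t =>
          BalancedTensor.map A f.hom LinearMap.id (b • t) =
            b • BalancedTensor.map A f.hom LinearMap.id t) ?_ ?_ ?_ t
        · simp
        · intro x y; rfl
        · intro s t hs ht; simp only [smul_add, map_add, hs, ht] }

/-- For an `(A, B)`-bimodule `M`, the functor `- ⊗_A M` from right `A`-modules to right
`B`-modules. -/
noncomputable def tensorRight (M : CentralBimodule K A B) :
    ModuleCat.{u} Aᵐᵒᵖ ⥤ ModuleCat.{u} Bᵐᵒᵖ where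
  obj N := tensorRightObj M N
  map f := tensorRightMap M f
  map_id N := by
    refine ModuleCat.hom_ext (LinearMap.ext fun t => ?_)
    exact DFunLike.congr_fun (BalancedTensor.map_id A (M := N) (N := M)) t
  map_comp f g := by
    refine ModuleCat.hom_ext (LinearMap.ext fun t => ?_)
    exact DFunLike.congr_fun (BalancedTensor.map_comp A g.hom f.hom LinearMap.id
      (LinearMap.id : M →ₗ[A] M)) t

instance (M : CentralBimodule K A B) : (tensorRight M).Additive where
  map_add {_ _ f g} := by
    refine ModuleCat.hom_ext (LinearMap.ext fun t => ?_)
    exact DFunLike.congr_fun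
      (BalancedTensor.map_add_left A f.hom g.hom (LinearMap.id : M →ₗ[A] M)) t

/-- `M ⊗_B N` as a left `A`-module, for an `(A, B)`-bimodule `M` and a left `B`-module `N`. -/
noncomputable def tensorLeftObj (M : CentralBimodule K A B) (N : ModuleCat.{u} B) :
    ModuleCat.{u} A :=
  letI : Module A (BalancedTensor B M N) := BalancedTensor.leftModule B A
  ModuleCat.of A (BalancedTensor B M N)

/-- The left `A`-linear map `M ⊗_B f`. -/
noncomputable def tensorLeftMap (M : CentralBimodule K A B) {N N' : ModuleCat.{u} B}
    (f : N ⟶ N') : tensorLeftObj M N ⟶ tensorLeftObj M N' :=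
  letI : Module A (BalancedTensor B M N) := BalancedTensor.leftModule B A
  letI : Module A (BalancedTensor B M N') := BalancedTensor.leftModule B A
  ModuleCat.ofHom
    { toFun := BalancedTensor.map B LinearMap.id f.hom
      map_add' := map_add _
      map_smul' := fun a t => by
        refine BalancedTensor.induction B (p := fun t =>
          BalancedTensor.map B LinearMap.id f.hom (a • t) =
            a • BalancedTensor.map B LinearMap.id f.hom t) ?_ ?_ ?_ t
        · simp
        · intro x y; rfl
        · intro s t hs ht; simp only [smul_add, map_add, hs, ht] }

/-- For an `(A, B)`-bimodule `M`, the functor `M ⊗_B -` from left `B`-modules to left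
`A`-modules. -/
noncomputable def tensorLeft (M : CentralBimodule K A B) :
    ModuleCat.{u} B ⥤ ModuleCat.{u} A where
  obj N := tensorLeftObj M N
  map f := tensorLeftMap M f
  map_id N := by
    refine ModuleCat.hom_ext (LinearMap.ext fun t => ?_)
    exact DFunLike.congr_fun (BalancedTensor.map_id B (M := M) (N := N)) t
  map_comp f g := by
    refine ModuleCat.hom_ext (LinearMap.ext fun t => ?_)
    exact DFunLike.congr_fun (BalancedTensor.map_comp B (LinearMap.id : M →ₗ[Bᵐᵒᵖ] M)
      LinearMap.id g.hom f.hom) t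

instance (M : CentralBimodule K A B) : (tensorLeft M).Additive where
  map_add {_ _ f g} := by
    refine ModuleCat.hom_ext (LinearMap.ext fun t => ?_)
    exact DFunLike.congr_fun
      (BalancedTensor.map_add_right B (LinearMap.id : M →ₗ[Bᵐᵒᵖ] M) f.hom g.hom) t

/-- `Tor_j^A(N, M)` for a right `A`-module `N` and an `(A, B)`-bimodule `M`, as a right
`B`-module. -/
noncomputable def torRight (M : CentralBimodule K A B) (j : ℕ) (N : ModuleCat.{u} Aᵐᵒᵖ) :
    ModuleCat.{u} Bᵐᵒᵖ :=
  ((tensorRight M).leftDerived j).obj N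

/-- `Tor_j^B(M, N)` for an `(A, B)`-bimodule `M` and a left `B`-module `N`, as a left
`A`-module. -/
noncomputable def torLeft (M : CentralBimodule K A B) (j : ℕ) (N : ModuleCat.{u} B) : ModuleCat.{u} A :=
  ((tensorLeft M).leftDerived j).obj N

end CentralBimodule

/-! ### Dimension functions -/

/-- A numerical function on left modules over `K`-algebras. Its values on right `A`-modules are
its values on modules over `Aᵐᵒᵖ`. -/
abbrev DimFunction (K : Type v) [CommRing K] : Type (max v (u + 1)) :=
  ∀ (A : Type u) [Ring A] [Algebra K A] (M : Type u) [AddCommGroup M] [Module A M], EReal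

section Dimension

variable {K : Type v} [CommRing K]

/-- `δ` is an exact dimension function on left `A`-modules, with values in `ℝ≥0 ∪ {±∞}`. -/
structure IsExactDimension (δ : DimFunction.{v, u} K) (A : Type u) [Ring A] [Algebra K A] :
    Prop where
  /-- The only value outside `[0, ∞]` is `-∞`. -/
  eq_bot_or_nonneg : ∀ (M : Type u) [AddCommGroup M] [Module A M], δ A M = ⊥ ∨ 0 ≤ δ A M
  eq_bot_iff : ∀ (M : Type u) [AddCommGroup M] [Module A M], δ A M = ⊥ ↔ Subsingleton M
  /-- `δ` depends only on the isomorphism class of a module. -/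
  congr : ∀ (M N : Type u) [AddCommGroup M] [Module A M] [AddCommGroup N] [Module A N],
    (M ≃ₗ[A] N) → δ A M = δ A N
  exact : ∀ (M : Type u) [AddCommGroup M] [Module A M] (N : Submodule A M),
    δ A M = max (δ A N) (δ A (M ⧸ N))
  /-- Compatibility with unions of directed systems of submodules. -/
  directed : ∀ (M : Type u) [AddCommGroup M] [Module A M] (S : Set (Submodule A M)),
    S.Nonempty → DirectedOn (· ≤ ·) S → δ A ↥(sSup S) = sSup ((fun N : Submodule A M => δ A N) '' S)

/-- `∂(A)`, the dimension of `A` as a right module over itself. -/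
def DimFunction.alg (δ : DimFunction.{v, u} K) (A : Type u) [Ring A] [Algebra K A] : EReal :=
  δ Aᵐᵒᵖ A

/-- For every `(A, B)`-bimodule `M`: if `M` is finitely generated over `B` then
`∂(_A M) ≤ ∂(M_B)`, and if `M` is finitely generated over `A` then `∂(M_B) ≤ ∂(_A M)`. -/
def IsSymmetricDimension (δ : DimFunction.{v, u} K) (A B : Type u) [Ring A] [Algebra K A] [Ring B]
    [Algebra K B] : Prop :=
  ∀ M : CentralBimodule K A B,
    (Module.Finite Bᵐᵒᵖ M → δ A M ≤ δ Bᵐᵒᵖ M) ∧ (Module.Finite A M → δ Bᵐᵒᵖ M ≤ δ A M)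

/-- `M` is a finitely generated left `A`-module of dimension at most `n`. -/
def IsSmallFG (δ : DimFunction.{v, u} K) (n : EReal) (A : Type u) [Ring A] [Algebra K A]
    (M : Type u) [AddCommGroup M] [Module A M] : Prop :=
  Module.Finite A M ∧ δ A M ≤ n

/-- The condition `γ_{n,i}(A, B)`: for every `(A, B)`-bimodule `M` finitely generated on both sides
and all `j ≤ i`, the functors `Tor_j^A(-, M)` and `Tor_j^B(M, -)` preserve finitely generated modules
of dimension at most `n`. -/
def GammaCondition (δ : DimFunction.{v, u} K) (n : EReal) (i : ℕ) (A B : Type u) [Ring A]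
    [Algebra K A] [Ring B] [Algebra K B] : Prop :=
  ∀ M : CentralBimodule K A B, M.IsFG →
    (∀ N : ModuleCat.{u} Aᵐᵒᵖ, IsSmallFG δ n Aᵐᵒᵖ N →
      ∀ j ≤ i, IsSmallFG δ n Bᵐᵒᵖ (M.torRight j N)) ∧
    (∀ N : ModuleCat.{u} B, IsSmallFG δ n B N →
      ∀ j ≤ i, IsSmallFG δ n A (M.torLeft j N))

/-- Two `(D, A)`-bimodules `X`, `Y` are `n`-isomorphic: there are a `(D, A)`-bimodule `P` and bimodule
morphisms `X → P ← Y` whose kernels and cokernels have dimension at most `n` as right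
`A`-modules. -/
def NIsomorphic (δ : DimFunction.{v, u} K) (n : EReal) {D A : Type u} [Ring D] [Algebra K D] [Ring A]
    [Algebra K A] (X Y : CentralBimodule K D A) : Prop :=
  ∃ (P : CentralBimodule K D A) (f : X →ₗ[Aᵐᵒᵖ] P) (g : Y →ₗ[Aᵐᵒᵖ] P),
    (∀ (d : D) (x : X), f (d • x) = d • f x) ∧ (∀ (d : D) (y : Y), g (d • y) = d • g y) ∧
    δ Aᵐᵒᵖ (LinearMap.ker f) ≤ n ∧ δ Aᵐᵒᵖ (P ⧸ LinearMap.range f) ≤ n ∧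
    δ Aᵐᵒᵖ (LinearMap.ker g) ≤ n ∧ δ Aᵐᵒᵖ (P ⧸ LinearMap.range g) ≤ n

end Dimension

/-! ### Grade, Auslander regularity and the Cohen–Macaulay property -/

section Homological

/-- `Ext_R^i(M, D)` for a left `R`-module `M` and a left `R`-module `D`. -/
abbrev ExtTo (R : Type u) [Ring R] (D : Type u) [AddCommGroup D] [Module R D]
    (M : Type u) [AddCommGroup M] [Module R M] (i : ℕ) : Type u :=
  Abelian.Ext.{u} (ModuleCat.of R M) (ModuleCat.of R D) i

/-- A ring `S` acting on `D` by `R`-linear maps acts on `Ext_R^i(M, D)` by functoriality in `D`. -/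
noncomputable instance ExtTo.module (R S : Type u) [Ring R] [Ring S] (D : Type u) [AddCommGroup D]
    [Module R D] [Module S D] [SMulCommClass S R D] (M : Type u) [AddCommGroup M] [Module R M]
    (i : ℕ) : Module S (ExtTo R D M i) where
  smul s e := e.comp (Abelian.Ext.mk₀ (ModuleCat.ofHom (Module.toModuleEnd R (S := S) D s)))
    (add_zero i)
  one_smul e := by
    change e.comp (Abelian.Ext.mk₀ (ModuleCat.ofHom (Module.toModuleEnd R (S := S) D 1))) _ = e
    rw [map_one]
    exact Abelian.Ext.comp_mk₀_id e
  mul_smul s t e := by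
    change e.comp (Abelian.Ext.mk₀ (ModuleCat.ofHom (Module.toModuleEnd R (S := S) D (s * t)))) _ =
      (e.comp (Abelian.Ext.mk₀ (ModuleCat.ofHom (Module.toModuleEnd R (S := S) D t))) _).comp
        (Abelian.Ext.mk₀ (ModuleCat.ofHom (Module.toModuleEnd R (S := S) D s))) _
    rw [Abelian.Ext.comp_assoc_of_third_deg_zero, Abelian.Ext.mk₀_comp_mk₀, map_mul]
    rfl
  smul_zero s := Abelian.Ext.zero_comp _ _ _ _ _
  smul_add s e e' := Abelian.Ext.add_comp _ _ _ _
  add_smul s t e := by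
    change e.comp (Abelian.Ext.mk₀ (ModuleCat.ofHom (Module.toModuleEnd R (S := S) D (s + t)))) _ =
      e.comp (Abelian.Ext.mk₀ (ModuleCat.ofHom (Module.toModuleEnd R (S := S) D s))) _ +
      e.comp (Abelian.Ext.mk₀ (ModuleCat.ofHom (Module.toModuleEnd R (S := S) D t))) _
    rw [← Abelian.Ext.comp_add, ← Abelian.Ext.mk₀_add, map_add]
    rfl
  zero_smul e := by
    change e.comp (Abelian.Ext.mk₀ (ModuleCat.ofHom (Module.toModuleEnd R (S := S) D 0))) _ = 0
    rw [map_zero]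
    change e.comp (Abelian.Ext.mk₀ 0) _ = 0
    rw [Abelian.Ext.mk₀_zero, Abelian.Ext.comp_zero]

/-- The least `i` with `Ext_R^i(M, D) ≠ 0`, and `∞` if there is none. For `R = A`, `D = A`
(respectively `R = Aᵐᵒᵖ`, `D = A`) it is the grade number of the left (right) `A`-module `M`. -/
noncomputable def gradeNumber (R : Type u) [Ring R] (D : Type u) [AddCommGroup D] [Module R D]
    (M : Type u) [AddCommGroup M] [Module R M] : ℕ∞ :=
  sInf {n : ℕ∞ | ∃ i : ℕ, n = i ∧ Nontrivial (ExtTo R D M i)}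

/-- The Auslander condition for all finitely generated `R`-modules `M`: for all `q`, every
`S`-submodule of `Ext_R^q(M, D)` has grade at least `q`. For `D = A` and `(R, S) = (Aᵐᵒᵖ, A)` (or
`(A, Aᵐᵒᵖ)`) it is the condition for the right (left) `A`-modules. -/
def AuslanderCondition (R S : Type u) [Ring R] [Ring S] (D : Type u) [AddCommGroup D]
    [Module R D] [Module S D] [SMulCommClass S R D] : Prop :=
  ∀ (M : Type u) [AddCommGroup M] [Module R M], Module.Finite R M →
    ∀ (q : ℕ) (N : Submodule S (ExtTo R D M q)), (q : ℕ∞) ≤ gradeNumber S D N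

/-- The global dimension of `A`, computed with right modules. -/
noncomputable def globalDim (A : Type u) [Ring A] : WithBot ℕ∞ :=
  ⨆ M : ModuleCat.{u} Aᵐᵒᵖ, projectiveDimension M

/-- Auslander regular: finite global dimension, and the Auslander condition holds for all finitely
generated left and right modules. -/
def IsAuslanderRegular (A : Type u) [Ring A] : Prop :=
  (∃ n : ℕ, globalDim A = n) ∧ AuslanderCondition Aᵐᵒᵖ A A ∧ AuslanderCondition A Aᵐᵒᵖ A

/-- `∂`-Cohen–Macaulay: `∂(A) ∈ ℕ`, and `j(M) + ∂(M) = ∂(A)` for all nonzero finitely generated right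
modules and all nonzero finitely generated left modules `M`. -/
def IsDimCM {K : Type v} [CommRing K] (δ : DimFunction.{v, u} K) (A : Type u) [Ring A]
    [Algebra K A] : Prop :=
  (∃ d : ℕ, δ.alg A = d) ∧
  (∀ (M : Type u) [AddCommGroup M] [Module Aᵐᵒᵖ M], Module.Finite Aᵐᵒᵖ M → Nontrivial M →
    ((gradeNumber Aᵐᵒᵖ A M : ENNReal) : EReal) + δ Aᵐᵒᵖ M = δ.alg A) ∧
  (∀ (M : Type u) [AddCommGroup M] [Module A M], Module.Finite A M → Nontrivial M →
    ((gradeNumber A A M : ENNReal) : EReal) + δ A M = δ.alg A)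

end Homological

/-! ### The ambient class of algebras and noncommutative quasi-resolutions -/

/-- A class of (left and right) noetherian `K`-algebras which contains `A` if and only if it contains
the opposite algebra of `A`. -/
structure AlgebraClass (K : Type v) [CommRing K] where
  /-- Membership in the class. -/
  Mem : ∀ (A : Type u) [Ring A] [Algebra K A], Prop
  noetherian_left : ∀ (A : Type u) [Ring A] [Algebra K A], Mem A → IsNoetherianRing A
  noetherian_right : ∀ (A : Type u) [Ring A] [Algebra K A], Mem A → IsNoetherianRing Aᵐᵒᵖ
  mem_op_iff : ∀ (A : Type u) [Ring A] [Algebra K A], Mem Aᵐᵒᵖ ↔ Mem A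

section Main

variable {K : Type v} [CommRing K]

/-- The standing hypothesis on the class `𝒜` and the dimension function `δ`. -/
structure StandingHypothesis (𝒜 : AlgebraClass.{v, u} K) (δ : DimFunction.{v, u} K) : Prop where
  exact_left : ∀ (A : Type u) [Ring A] [Algebra K A], 𝒜.Mem A → IsExactDimension δ A
  exact_right : ∀ (A : Type u) [Ring A] [Algebra K A], 𝒜.Mem A → IsExactDimension δ Aᵐᵒᵖ
  dim_nat : ∀ (A : Type u) [Ring A] [Algebra K A], 𝒜.Mem A → ∃ d : ℕ, δ.alg A = d
  symmetric : ∀ (A B : Type u) [Ring A] [Algebra K A] [Ring B] [Algebra K B],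
    𝒜.Mem A → 𝒜.Mem B → IsSymmetricDimension δ A B
  gamma : ∀ (A B : Type u) [Ring A] [Algebra K A] [Ring B] [Algebra K B],
    𝒜.Mem A → 𝒜.Mem B → δ.alg A = δ.alg B → GammaCondition δ (δ.alg A - 2) 1 A B

/-- `(B, M, N)` is a noncommutative quasi-resolution of `A`: with `d = ∂(A)`, `B` is an Auslander
regular `∂`-Cohen–Macaulay algebra in the class with `∂(B) = d`, and the `(B, A)`-bimodule `M` and the
`(A, B)`-bimodule `N` are finitely generated on both sides and satisfy `M ⊗_A N ≅_{d-2} B` and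
`N ⊗_B M ≅_{d-2} A` as bimodules. -/
structure IsNQR (𝒜 : AlgebraClass.{v, u} K) (δ : DimFunction.{v, u} K) (A : Type u) [Ring A]
    [Algebra K A] (B : Type u) [Ring B] [Algebra K B] (M : CentralBimodule K B A)
    (N : CentralBimodule K A B) : Prop where
  mem : 𝒜.Mem B
  auslanderRegular : IsAuslanderRegular B
  cohenMacaulay : IsDimCM δ B
  dim_eq : δ.alg B = δ.alg A
  fg_left : M.IsFG
  fg_right : N.IsFG
  iso_left : NIsomorphic δ (δ.alg A - 2) (M.tensor N) (CentralBimodule.regular K B)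
  iso_right : NIsomorphic δ (δ.alg A - 2) (N.tensor M) (CentralBimodule.regular K A)

end Main

/-!
Put `d = ∂(A)`, call a module small if its dimension is at most `d - 2`, and call a linear map an
almost isomorphism if its kernel and cokernel are small. Then `D = M₁ ⊗ N₂` and `E = M₂ ⊗ N₁` are
almost inverse to each other: by `γ`, tensoring preserves almost isomorphisms, and a projective
module over a Cohen–Macaulay algebra is closed, that is, maps into it extend uniquely along almost
isomorphisms, so `D ⊗ E` has an almost isomorphism to `B₁` and `E ⊗ D` one to `B₂`.

Now replace `D` and `E` by their double duals. Over an Auslander regular Cohen–Macaulay algebra of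
dimension at most `2`, duals are projective, being second syzygies over a ring of global dimension
at most `2`. The map `D → D**` is an almost isomorphism: almost all of `B₁` multiplies its kernel
into a small submodule, and its cokernel consists of `Ext`-modules of grade at least `2`. So the
pairings extend to almost isomorphisms `D** ⊗ E** → B₁` and `E** ⊗ D** → B₂`. An almost isomorphism
between closed modules is bijective, so `D**` and `E**` are inverse bimodules.
-/

/-! ### Dimension estimates and almost isomorphisms -/

section AlmostIso

variable {K : Type v} [CommRing K] {δ : DimFunction.{v, u} K} {n : EReal} {R : Type u} [Ring R]
  [Algebra K R] {X Y Z : Type u} [AddCommGroup X] [Module R X] [AddCommGroup Y] [Module R Y]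
  [AddCommGroup Z] [Module R Z]

namespace IsExactDimension

theorem le_of_injective (hδ : IsExactDimension δ R) {f : X →ₗ[R] Y} (hf : Function.Injective f)
    (hY : δ R Y ≤ n) : δ R X ≤ n := by
  rw [hδ.congr _ _ (LinearEquiv.ofInjective f hf)]
  rw [hδ.exact Y (LinearMap.range f)] at hY
  exact (le_max_left _ _).trans hY

theorem le_of_surjective (hδ : IsExactDimension δ R) {f : X →ₗ[R] Y} (hf : Function.Surjective f)
    (hX : δ R X ≤ n) : δ R Y ≤ n := by
  rw [← hδ.congr _ _ (f.quotKerEquivOfSurjective hf)]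
  rw [hδ.exact X (LinearMap.ker f)] at hX
  exact (le_max_right _ _).trans hX

theorem le_of_subsingleton (hδ : IsExactDimension δ R) [Subsingleton X] : δ R X ≤ n :=
  ((hδ.eq_bot_iff X).2 inferInstance).trans_le bot_le

theorem range_le (hδ : IsExactDimension δ R) (f : X →ₗ[R] Y) (hX : δ R X ≤ n) :
    δ R (LinearMap.range f) ≤ n :=
  hδ.le_of_surjective f.surjective_rangeRestrict hX

theorem submodule_mono (hδ : IsExactDimension δ R) {P Q : Submodule R X} (hPQ : P ≤ Q)
    (hQ : δ R Q ≤ n) : δ R P ≤ n :=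
  hδ.le_of_injective (Submodule.inclusion_injective hPQ) hQ

theorem submodule_map_le (hδ : IsExactDimension δ R) (f : X →ₗ[R] Y) {P : Submodule R X}
    (hP : δ R P ≤ n) : δ R (P.map f) ≤ n := by
  rw [← LinearMap.range_domRestrict]
  exact hδ.range_le _ hP

theorem le_of_ker_le_range (hδ : IsExactDimension δ R) (f : X →ₗ[R] Y) (g : Y →ₗ[R] Z)
    (hfg : LinearMap.ker g ≤ LinearMap.range f) (hX : δ R X ≤ n) (hZ : δ R Z ≤ n) :
    δ R Y ≤ n := by
  rw [hδ.exact Y (LinearMap.ker g), hδ.congr _ _ g.quotKerEquivRange]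
  exact max_le (hδ.submodule_mono hfg (hδ.range_le f hX))
    (hδ.le_of_injective (LinearMap.range g).injective_subtype hZ)

theorem prod_le (hδ : IsExactDimension δ R) (hX : δ R X ≤ n) (hY : δ R Y ≤ n) :
    δ R (X × Y) ≤ n :=
  hδ.le_of_ker_le_range (LinearMap.inl R X Y) (LinearMap.snd R X Y)
    (LinearMap.ker_snd R X Y).le hX hY

theorem pi_le (hδ : IsExactDimension δ R) (hX : δ R X ≤ n) (k : ℕ) : δ R (Fin k → X) ≤ n := by
  induction k with
  | zero => exact hδ.le_of_subsingleton
  | succ k ih =>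
    rw [← hδ.congr _ _ (Fin.consLinearEquiv R fun _ : Fin (k + 1) => X)]
    exact hδ.prod_le hX ih

theorem submodule_le_of_inf_ker_le (hδ : IsExactDimension δ R) {P : Submodule R X} (p : X →ₗ[R] Y)
    (hker : δ R ↥(P ⊓ LinearMap.ker p) ≤ n) (hmap : δ R (P.map p) ≤ n) : δ R P ≤ n := by
  refine hδ.le_of_ker_le_range (Submodule.inclusion inf_le_left)
    (p.restrict fun _ => Submodule.mem_map_of_mem) ?_ hker hmap
  rw [Submodule.range_inclusion]
  exact fun x hx => ⟨x.2, congrArg Subtype.val hx⟩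

theorem submodule_map_le_of_map_inf_ker_le (hδ : IsExactDimension δ R) {P : Submodule R X}
    (f : X →ₗ[R] Y) (p : X →ₗ[R] Z) (hker : δ R ((P ⊓ LinearMap.ker p).map f) ≤ n)
    (hmap : δ R (P.map p) ≤ n) : δ R (P.map f) ≤ n := by
  have hgraph : δ R (P.map (f.prod p)) ≤ n := by
    refine hδ.submodule_le_of_inf_ker_le (LinearMap.snd R Y Z)
      (hδ.submodule_mono ?_ (hδ.submodule_map_le (LinearMap.inl R Y Z) hker)) ?_
    · rintro _ ⟨⟨x, hx, rfl⟩, hx'⟩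
      exact ⟨f x, ⟨x, ⟨hx, hx'⟩, rfl⟩, Prod.ext rfl (Eq.symm hx')⟩
    · rwa [← Submodule.map_comp, LinearMap.snd_prod]
  rw [← LinearMap.fst_prod f p, Submodule.map_comp]
  exact hδ.submodule_map_le _ hgraph

theorem ker_le_of_four_lemma (hδ : IsExactDimension δ R) {K₁ F₁ X₁ K₂ F₂ X₂ : Type u}
    [AddCommGroup K₁] [Module R K₁] [AddCommGroup F₁] [Module R F₁] [AddCommGroup X₁] [Module R X₁]
    [AddCommGroup K₂] [Module R K₂] [AddCommGroup F₂] [Module R F₂] [AddCommGroup X₂] [Module R X₂]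
    {u₁ : K₁ →ₗ[R] F₁} {v₁ : F₁ →ₗ[R] X₁} {u₂ : K₂ →ₗ[R] F₂} {v₂ : F₂ →ₗ[R] X₂}
    {α : K₁ →ₗ[R] K₂} {β : F₁ →ₗ[R] F₂} {γ : X₁ →ₗ[R] X₂} (hv₁ : Function.Surjective v₁)
    (h₁ : v₁ ∘ₗ u₁ = 0) (h₂ : LinearMap.ker v₂ ≤ LinearMap.range u₂)
    (hαβ : β ∘ₗ u₁ = u₂ ∘ₗ α) (hβγ : γ ∘ₗ v₁ = v₂ ∘ₗ β)
    (hα : δ R (K₂ ⧸ LinearMap.range α) ≤ n) (hβ : δ R (LinearMap.ker β) ≤ n) :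
    δ R (LinearMap.ker γ) ≤ n := by
  let U := LinearMap.range (u₂ ∘ₗ α)
  let ubar : (K₂ ⧸ LinearMap.range α) →ₗ[R] F₂ ⧸ U :=
    (LinearMap.range α).mapQ U u₂ (by rintro _ ⟨k, rfl⟩; exact ⟨k, rfl⟩)
  rw [← Submodule.map_comap_eq_of_surjective hv₁ (LinearMap.ker γ), ← LinearMap.ker_comp, hβγ]
  refine hδ.submodule_map_le_of_map_inf_ker_le v₁ (U.mkQ ∘ₗ β)
    (hδ.submodule_mono ?_ (hδ.submodule_map_le v₁ hβ))
    (hδ.submodule_mono ?_ (hδ.range_le ubar hα))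
  · rintro _ ⟨x, ⟨-, hx⟩, rfl⟩
    obtain ⟨k, hk⟩ := (Submodule.Quotient.mk_eq_zero U).1 hx
    refine ⟨x - u₁ k, ?_, ?_⟩
    · have hk' : β (u₁ k) = β x := (LinearMap.congr_fun hαβ k).trans hk
      exact LinearMap.mem_ker.2 (by rw [map_sub, hk', sub_self])
    · have hk' : v₁ (u₁ k) = 0 := LinearMap.congr_fun h₁ k
      rw [map_sub, hk', sub_zero]
  · rintro _ ⟨x, hx, rfl⟩
    obtain ⟨k, hk⟩ := h₂ hx
    exact ⟨Submodule.Quotient.mk k, congrArg U.mkQ hk⟩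

end IsExactDimension

/-- A linear map whose kernel and cokernel have dimension at most `n`: an isomorphism up to
modules of dimension at most `n`. -/
structure IsAlmostIso (δ : DimFunction.{v, u} K) (n : EReal) (f : X →ₗ[R] Y) : Prop where
  ker_le : δ R (LinearMap.ker f) ≤ n
  coker_le : δ R (Y ⧸ LinearMap.range f) ≤ n

namespace IsAlmostIso

theorem of_bijective (hδ : IsExactDimension δ R) {f : X →ₗ[R] Y} (hf : Function.Bijective f) :
    IsAlmostIso δ n f where
  ker_le := by
    rw [LinearMap.ker_eq_bot.2 hf.1]
    exact hδ.le_of_subsingleton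
  coker_le := by
    rw [LinearMap.range_eq_top.2 hf.2]
    exact hδ.le_of_subsingleton

theorem comp (hδ : IsExactDimension δ R) {f : X →ₗ[R] Y} {g : Y →ₗ[R] Z}
    (hg : IsAlmostIso δ n g) (hf : IsAlmostIso δ n f) : IsAlmostIso δ n (g ∘ₗ f) where
  ker_le := by
    refine hδ.submodule_le_of_inf_ker_le f (hδ.submodule_mono inf_le_right hf.ker_le)
      (hδ.submodule_mono ?_ hg.ker_le)
    rintro _ ⟨x, hx, rfl⟩
    exact hx
  coker_le := by
    refine hδ.le_of_ker_le_range
      ((LinearMap.range f).mapQ (LinearMap.range (g ∘ₗ f)) g ?_)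
      (Submodule.factor (LinearMap.range_comp_le_range f g)) ?_ hf.coker_le hg.coker_le
    · rintro _ ⟨x, rfl⟩
      exact ⟨x, rfl⟩
    · intro z hz
      obtain ⟨z, rfl⟩ := Submodule.Quotient.mk_surjective _ z
      obtain ⟨y, rfl⟩ := (Submodule.Quotient.mk_eq_zero _).1 hz
      exact ⟨Submodule.Quotient.mk y, rfl⟩

theorem of_comp (hδ : IsExactDimension δ R) {f : X →ₗ[R] Y} {g : Y →ₗ[R] Z}
    (hf : IsAlmostIso δ n f) (hgf : IsAlmostIso δ n (g ∘ₗ f)) : IsAlmostIso δ n g where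
  ker_le := by
    refine hδ.le_of_ker_le_range (f.restrict fun _ hx => hx)
      ((LinearMap.range f).mkQ ∘ₗ (LinearMap.ker g).subtype) ?_ hgf.ker_le hf.coker_le
    rintro ⟨y, hy⟩ hy'
    obtain ⟨x, rfl⟩ := (Submodule.Quotient.mk_eq_zero _).1 hy'
    exact ⟨⟨x, hy⟩, rfl⟩
  coker_le :=
    hδ.le_of_surjective (Submodule.factor_surjective (LinearMap.range_comp_le_range f g))
      hgf.coker_le

theorem codRestrict (hδ : IsExactDimension δ R) {f : X →ₗ[R] Y} (hf : IsAlmostIso δ n f)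
    {S : Submodule R Y} (hS : ∀ x, f x ∈ S) : IsAlmostIso δ n (f.codRestrict S hS) where
  ker_le := by
    rw [LinearMap.ker_codRestrict]
    exact hf.ker_le
  coker_le := by
    refine hδ.le_of_injective (f := Submodule.mapQ _ (LinearMap.range f) S.subtype ?_)
      (LinearMap.ker_eq_bot.1 (Submodule.ker_liftQ_eq_bot _ _ _ fun y hy => ?_)) hf.coker_le
    · rintro _ ⟨x, rfl⟩
      exact ⟨x, rfl⟩
    · obtain ⟨x, hx⟩ := (Submodule.Quotient.mk_eq_zero _).1 hy
      exact ⟨x, Subtype.ext hx⟩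

end IsAlmostIso

end AlmostIso

/-! ### Balanced tensor products: linearity, exactness, associativity -/

namespace BalancedTensor

attribute [local instance] leftModule rightModule

section Lift

variable {A : Type u} [Ring A] {M M' M'' N N' : Type u}
  [AddCommGroup M] [Module Aᵐᵒᵖ M] [AddCommGroup M'] [Module Aᵐᵒᵖ M']
  [AddCommGroup M''] [Module Aᵐᵒᵖ M''] [AddCommGroup N] [Module A N] [AddCommGroup N'] [Module A N']

/-- The additive map out of `M ⊗_A N` induced by a balanced biadditive map. -/
noncomputable def lift {G : Type*} [AddCommGroup G] (β : M → N → G)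
    (add_left : ∀ x x' y, β (x + x') y = β x y + β x' y)
    (add_right : ∀ x y y', β x (y + y') = β x y + β x y')
    (balanced : ∀ x (a : A) y, β (op a • x) y = β x (a • y)) : BalancedTensor A M N →+ G :=
  QuotientAddGroup.lift _
    (TensorProduct.liftAddHom
      (AddMonoidHom.mk' (fun x => AddMonoidHom.mk' (β x) (add_right x)) fun x x' =>
        AddMonoidHom.ext (add_left x x'))
      fun r x y => by rw [map_zsmul, map_zsmul]; rfl)
    ((AddSubgroup.closure_le _).2 <| by
      rintro _ ⟨x, a, y, rfl⟩
      simp [balanced])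

theorem map_smul_of_tmul {S G : Type*} [Ring S] [Module S (BalancedTensor A M N)] [AddCommGroup G]
    [Module S G] (φ : BalancedTensor A M N →+ G)
    (hφ : ∀ (s : S) x y, φ (s • tmul A x y) = s • φ (tmul A x y)) (s : S)
    (t : BalancedTensor A M N) : φ (s • t) = s • φ t := by
  induction t using induction with
  | zero => rw [smul_zero, map_zero, smul_zero]
  | tmul x y => exact hφ s x y
  | add t t' h h' => rw [smul_add, map_add, map_add, h, h', smul_add]

theorem linearMap_ext {S G : Type*} [Ring S] [Module S (BalancedTensor A M N)] [AddCommGroup G]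
    [Module S G] {φ ψ : BalancedTensor A M N →ₗ[S] G}
    (h : ∀ x y, φ (tmul A x y) = ψ (tmul A x y)) : φ = ψ :=
  LinearMap.toAddMonoidHom_injective (hom_ext A h)

section RightAction

variable {S : Type*} [Ring S] [Module S N] [SMulCommClass S A N] [Module S N']
  [SMulCommClass S A N']

/-- `x ⊗ -` as a linear map, for a ring acting on the right factor. -/
noncomputable def mkRight (S : Type*) [Ring S] [Module S N] [SMulCommClass S A N] (x : M) :
    N →ₗ[S] BalancedTensor A M N where
  toFun := tmul A x
  map_add' := tmul_add A x
  map_smul' _ _ := rfl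

/-- `f ⊗ g` as an `S`-linear map, for `g` linear over both `A` and `S`. -/
noncomputable def mapRight (f : M →ₗ[Aᵐᵒᵖ] M') (g : N →ₗ[S] N')
    (hg : ∀ (a : A) y, g (a • y) = a • g y) :
    BalancedTensor A M N →ₗ[S] BalancedTensor A M' N' where
  toFun := map A f { g with map_smul' := hg }
  map_add' := map_add _
  map_smul' := map_smul_of_tmul _ fun s x y => congrArg (tmul A (f x)) (map_smul g s y)

/-- The `S`-linear map `f ⊗_A N`, for `S` acting on `N`. -/
noncomputable abbrev rTensor (S : Type*) [Ring S] (N : Type u) [AddCommGroup N] [Module A N]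
    [Module S N] [SMulCommClass S A N] (f : M →ₗ[Aᵐᵒᵖ] M') :
    BalancedTensor A M N →ₗ[S] BalancedTensor A M' N :=
  mapRight f LinearMap.id fun _ _ => rfl

theorem rTensor_comp (f : M →ₗ[Aᵐᵒᵖ] M') (f' : M' →ₗ[Aᵐᵒᵖ] M'') :
    rTensor S N (f' ∘ₗ f) = rTensor S N f' ∘ₗ rTensor S N f :=
  linearMap_ext fun _ _ => rfl

theorem rTensor_zero : rTensor S N (0 : M →ₗ[Aᵐᵒᵖ] M') = 0 :=
  linearMap_ext fun _ y => zero_tmul A y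

end RightAction

section LeftAction

variable {S : Type*} [Ring S] [Module S M] [SMulCommClass S Aᵐᵒᵖ M]

/-- `- ⊗ y` as a linear map, for a ring acting on the left factor. -/
noncomputable def mkLeft (S : Type*) [Ring S] [Module S M] [SMulCommClass S Aᵐᵒᵖ M] (y : N) :
    M →ₗ[S] BalancedTensor A M N where
  toFun x := tmul A x y
  map_add' x x' := add_tmul A x x' y
  map_smul' _ _ := rfl

theorem finite_left [Module.Finite S M] [Module.Finite A N] :
    Module.Finite S (BalancedTensor A M N) := by
  obtain ⟨k, y, hy⟩ := Module.Finite.exists_fin (R := A) (M := N)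
  let F : (Fin k → M) →ₗ[S] BalancedTensor A M N :=
    LinearMap.lsum S (fun _ => M) ℕ fun i => mkLeft (A := A) S (y i)
  suffices ∀ x z, tmul A x z ∈ LinearMap.range F from
    Module.Finite.of_surjective F fun t =>
      induction A (zero_mem (LinearMap.range F)) this (fun _ _ => add_mem) t
  intro x z
  have hz : z ∈ Submodule.span A (Set.range y) := hy ▸ Submodule.mem_top
  induction hz using Submodule.span_induction generalizing x with
  | mem z hz =>
    obtain ⟨i, rfl⟩ := hz
    exact ⟨Pi.single i x, LinearMap.lsum_piSingle ..⟩
  | zero => rw [tmul_zero]; exact zero_mem _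
  | add z z' _ _ h h' => rw [tmul_add]; exact add_mem (h x) (h' x)
  | smul a z _ h => rw [← smul_tmul]; exact h _

end LeftAction

section Commute

variable {S T : Type*} [Ring S] [Ring T] [Module S M] [SMulCommClass S Aᵐᵒᵖ M] [Module T N]
  [SMulCommClass T A N]

instance smulCommClass_left_right : SMulCommClass S T (BalancedTensor A M N) where
  smul_comm s t z := by
    induction z using induction with
    | zero => simp only [smul_zero]
    | tmul x y => rfl
    | add z z' h h' => simp only [smul_add, h, h']

instance smulCommClass_right_left : SMulCommClass T S (BalancedTensor A M N) :=
  SMulCommClass.symm _ _ _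

end Commute

section Exactness

theorem map_surjective {f : M →ₗ[Aᵐᵒᵖ] M'} {g : N →ₗ[A] N'} (hf : Function.Surjective f)
    (hg : Function.Surjective g) : Function.Surjective (map A f g) := by
  intro t
  induction t using induction with
  | zero => exact ⟨0, map_zero _⟩
  | tmul x y =>
    obtain ⟨x, rfl⟩ := hf x
    obtain ⟨y, rfl⟩ := hg y
    exact ⟨tmul A x y, rfl⟩
  | add _ _ h h' =>
    obtain ⟨s, rfl⟩ := h
    obtain ⟨s', rfl⟩ := h'
    exact ⟨s + s', map_add _ _ _⟩

theorem balancedRelations_le_map {f : M →ₗ[Aᵐᵒᵖ] M'} {g : N →ₗ[A] N'} (hf : Function.Surjective f)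
    (hg : Function.Surjective g) : balancedRelations A M' N' ≤ (balancedRelations A M N).map
      (TensorProduct.map f.toAddMonoidHom.toIntLinearMap
        g.toAddMonoidHom.toIntLinearMap).toAddMonoidHom := by
  refine (AddSubgroup.closure_le _).2 ?_
  rintro _ ⟨x, a, y, rfl⟩
  obtain ⟨x, rfl⟩ := hf x
  obtain ⟨y, rfl⟩ := hg y
  exact ⟨_, AddSubgroup.subset_closure ⟨x, a, y, rfl⟩, by simp⟩

theorem map_exact {f : M →ₗ[Aᵐᵒᵖ] M'} {f' : M' →ₗ[Aᵐᵒᵖ] M''} (h : Function.Exact f f')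
    (hf' : Function.Surjective f') :
    Function.Exact (map A f (LinearMap.id : N →ₗ[A] N)) (map A f' LinearMap.id) := by
  intro t
  constructor
  · intro ht
    obtain ⟨t, rfl⟩ := QuotientAddGroup.mk'_surjective _ t
    obtain ⟨r, hr, hrt⟩ := balancedRelations_le_map hf' (Function.surjective_id (α := N))
      (g := LinearMap.id) ((QuotientAddGroup.eq_zero_iff _).1 ht)
    -- Modulo the relation `r`, which dies in the quotient, `t` is killed by `f' ⊗_ℤ N`.
    obtain ⟨s, hs⟩ := (_root_.rTensor_exact N (f := f.toAddMonoidHom.toIntLinearMap)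
      (g := f'.toAddMonoidHom.toIntLinearMap) h hf' (t - r)).1
      ((map_sub _ t r).trans (sub_eq_zero.2 hrt.symm))
    refine ⟨QuotientAddGroup.mk' _ s, (congrArg (QuotientAddGroup.mk' _) hs).trans ?_⟩
    have hr' : QuotientAddGroup.mk' (balancedRelations A M' N) r = 0 :=
      (QuotientAddGroup.eq_zero_iff r).2 hr
    rw [map_sub, hr', sub_zero]
  · rintro ⟨s, rfl⟩
    rw [← AddMonoidHom.comp_apply, ← map_comp, h.linearMap_comp_eq_zero]
    exact DFunLike.congr_fun (hom_ext A (ψ := 0) fun _ y => zero_tmul A y) s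

end Exactness

section Free

variable (S : Type*) [Ring S] [Module S N] [SMulCommClass S A N]
  [Module S N'] [SMulCommClass S A N']

/-- The isomorphism `A ^ k ⊗_A N ≃ N ^ k`, with `A` as a right module over itself realized as
`Aᵐᵒᵖ`. -/
noncomputable def piTensorEquiv (A : Type u) [Ring A] (N : Type u) [AddCommGroup N] [Module A N]
    [Module S N] [SMulCommClass S A N] (k : ℕ) :
    BalancedTensor A (Fin k → Aᵐᵒᵖ) N ≃ₗ[S] (Fin k → N) :=
  let φ : BalancedTensor A (Fin k → Aᵐᵒᵖ) N →+ (Fin k → N) :=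
    lift (fun x y i => unop (x i) • y) (fun _ _ _ => funext fun _ => add_smul _ _ _)
      (fun _ _ _ => funext fun _ => smul_add _ _ _) fun _ _ _ => funext fun _ => mul_smul _ _ _
  { toFun := φ
    map_add' := map_add φ
    map_smul' := map_smul_of_tmul φ fun s x y => funext fun i => (smul_comm s (unop (x i)) y).symm
    invFun := fun y => ∑ i, tmul A (Pi.single i (1 : Aᵐᵒᵖ)) (y i)
    left_inv := fun t => by
      induction t using induction with
      | zero => simp only [map_zero, Pi.zero_apply, tmul_zero, Finset.sum_const_zero]
      | tmul x y =>
        have hx : ∑ i, x i • Pi.single i (1 : Aᵐᵒᵖ) = x := by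
          simp only [← Pi.single_smul, smul_eq_mul, mul_one, Finset.univ_sum_single]
        calc ∑ i, tmul A (Pi.single i (1 : Aᵐᵒᵖ)) (unop (x i) • y)
            = ∑ i, mkLeft ℤ y (x i • Pi.single i (1 : Aᵐᵒᵖ)) :=
              Finset.sum_congr rfl fun i _ => (smul_tmul A _ (unop (x i)) y).symm
          _ = tmul A x y := by rw [← map_sum, hx]; rfl
      | add t t' h h' =>
        simp only [map_add, Pi.add_apply, tmul_add, Finset.sum_add_distrib, h, h']
    right_inv := fun y => by
      ext i
      rw [map_sum, Finset.sum_apply, Finset.sum_eq_single i]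
      · exact (congrArg (fun a => unop a • y i) (Pi.single_eq_same i _)).trans (one_smul A _)
      · exact fun j _ hj =>
          (congrArg (fun a => unop a • y j) (Pi.single_eq_of_ne hj.symm _)).trans (zero_smul A _)
      · exact fun hi => absurd (Finset.mem_univ i) hi }

theorem piTensorEquiv_mapRight {k : ℕ} (f : N →ₗ[S] N') (hf : ∀ (a : A) y, f (a • y) = a • f y)
    (t : BalancedTensor A (Fin k → Aᵐᵒᵖ) N) (i : Fin k) :
    piTensorEquiv S A N' k (mapRight LinearMap.id f hf t) i = f (piTensorEquiv S A N k t i) := by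
  have h : (LinearMap.proj i ∘ₗ (piTensorEquiv S A N' k).toLinearMap) ∘ₗ
      mapRight LinearMap.id f hf = f ∘ₗ LinearMap.proj i ∘ₗ (piTensorEquiv S A N k).toLinearMap :=
    linearMap_ext fun x y => (hf (unop (x i)) y).symm
  exact LinearMap.congr_fun h t

theorem finite_right [Module.Finite Aᵐᵒᵖ M] [Module.Finite S N] :
    Module.Finite S (BalancedTensor A M N) := by
  obtain ⟨k, π, hπ⟩ := Module.Finite.exists_fin' Aᵐᵒᵖ M
  have : Module.Finite S (BalancedTensor A (Fin k → Aᵐᵒᵖ) N) :=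
    Module.Finite.equiv (piTensorEquiv S A N k).symm
  exact Module.Finite.of_surjective (rTensor S N π) (map_surjective hπ Function.surjective_id)

theorem projective_right [Module.Finite Aᵐᵒᵖ M] [Module.Projective Aᵐᵒᵖ M]
    [Module.Projective S N] : Module.Projective S (BalancedTensor A M N) := by
  obtain ⟨k, r, i, -, -, hri⟩ := Module.Finite.exists_comp_eq_id_of_projective Aᵐᵒᵖ M
  have : Module.Projective S (BalancedTensor A (Fin k → Aᵐᵒᵖ) N) :=
    .of_equiv (DFinsupp.linearEquivFunOnFintype.trans (piTensorEquiv S A N k).symm)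
  refine .of_split (rTensor S N i) (rTensor S N r) ?_
  rw [← rTensor_comp, hri]
  exact linearMap_ext fun _ _ => rfl

end Free

end Lift

section Assoc

variable {A B M N L : Type u} [Ring A] [Ring B] [AddCommGroup M] [Module Aᵐᵒᵖ M]
  [AddCommGroup N] [Module A N] [AddCommGroup L] [Module B L] [Module Bᵐᵒᵖ N]

theorem hom_ext₃ [SMulCommClass Bᵐᵒᵖ A N] {G : Type*} [AddCommGroup G]
    {φ ψ : BalancedTensor B (BalancedTensor A M N) L →+ G}
    (h : ∀ m n l, φ (tmul B (tmul A m n) l) = ψ (tmul B (tmul A m n) l)) : φ = ψ := by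
  refine hom_ext B fun t l => ?_
  induction t using induction with
  | zero => rw [zero_tmul, map_zero, map_zero]
  | tmul m n => exact h m n l
  | add t t' ht ht' => rw [add_tmul, map_add, map_add, ht, ht']

theorem hom_ext₃' [SMulCommClass A Bᵐᵒᵖ N] {G : Type*} [AddCommGroup G]
    {φ ψ : BalancedTensor A M (BalancedTensor B N L) →+ G}
    (h : ∀ m n l, φ (tmul A m (tmul B n l)) = ψ (tmul A m (tmul B n l))) : φ = ψ := by
  refine hom_ext A fun m t => ?_
  induction t using induction with
  | zero => rw [tmul_zero, map_zero, map_zero]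
  | tmul n l => exact h m n l
  | add t t' ht ht' => rw [tmul_add, map_add, map_add, ht, ht']

variable (A B M N L) [SMulCommClass Bᵐᵒᵖ A N] [SMulCommClass A Bᵐᵒᵖ N]

/-- The associativity isomorphism `(M ⊗_A N) ⊗_B L ≃ M ⊗_A (N ⊗_B L)`. -/
noncomputable def assoc :
    BalancedTensor B (BalancedTensor A M N) L ≃+ BalancedTensor A M (BalancedTensor B N L) :=
  AddMonoidHom.toAddEquiv
    (lift (fun t l => map A LinearMap.id (mkLeft A l) t)
      (fun _ _ _ => map_add _ _ _)
      (fun t l l' => DFunLike.congr_fun (hom_ext A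
        (φ := map A LinearMap.id (mkLeft A (l + l')))
        (ψ := map A LinearMap.id (mkLeft A l) + map A LinearMap.id (mkLeft A l')) fun m n =>
          (congrArg (tmul A m) (tmul_add B n l l')).trans (tmul_add A m _ _)) t)
      fun t b l => DFunLike.congr_fun (hom_ext A
        (φ := (map A LinearMap.id (mkLeft A l)).comp
          (DistribSMul.toAddMonoidHom (BalancedTensor A M N) (op b)))
        (ψ := map A LinearMap.id (mkLeft A (b • l))) fun m n =>
          congrArg (tmul A m) (smul_tmul B n b l)) t)
    (lift (fun m t => map B (mkRight Bᵐᵒᵖ m) LinearMap.id t)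
      (fun m m' t => DFunLike.congr_fun (hom_ext B
        (φ := map B (mkRight Bᵐᵒᵖ (m + m')) LinearMap.id)
        (ψ := map B (mkRight Bᵐᵒᵖ m) LinearMap.id + map B (mkRight Bᵐᵒᵖ m') LinearMap.id)
          fun n l => (congrArg (tmul B · l) (add_tmul A m m' n)).trans (add_tmul B _ _ l)) t)
      (fun _ _ _ => map_add _ _ _)
      fun m a t => DFunLike.congr_fun (hom_ext B
        (φ := map B (mkRight Bᵐᵒᵖ (op a • m)) LinearMap.id)
        (ψ := (map B (mkRight Bᵐᵒᵖ m) LinearMap.id).comp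
          (DistribSMul.toAddMonoidHom (BalancedTensor B N L) a))
          fun n l => congrArg (tmul B · l) (smul_tmul A m a n)) t)
    (hom_ext₃ fun _ _ _ => rfl) (hom_ext₃' fun _ _ _ => rfl)

variable {A B M N L}

theorem assoc_smul_of_right {S : Type*} [Ring S] [Module S L] [SMulCommClass S B L] (s : S)
    (t : BalancedTensor B (BalancedTensor A M N) L) :
    assoc A B M N L (s • t) = s • assoc A B M N L t :=
  DFunLike.congr_fun (hom_ext₃
    (φ := (assoc A B M N L).toAddMonoidHom.comp (DistribSMul.toAddMonoidHom _ s))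
    (ψ := (DistribSMul.toAddMonoidHom _ s).comp (assoc A B M N L).toAddMonoidHom)
    fun _ _ _ => rfl) t

theorem assoc_smul_of_left {S : Type*} [Ring S] [Module S M] [SMulCommClass S Aᵐᵒᵖ M] (s : S)
    (t : BalancedTensor B (BalancedTensor A M N) L) :
    assoc A B M N L (s • t) = s • assoc A B M N L t :=
  DFunLike.congr_fun (hom_ext₃
    (φ := (assoc A B M N L).toAddMonoidHom.comp (DistribSMul.toAddMonoidHom _ s))
    (ψ := (DistribSMul.toAddMonoidHom _ s).comp (assoc A B M N L).toAddMonoidHom)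
    fun _ _ _ => rfl) t

end Assoc

section Unit

variable (A M N : Type u) [Ring A] [AddCommGroup M] [Module Aᵐᵒᵖ M] [AddCommGroup N] [Module A N]

/-- The action isomorphism `A ⊗_A N ≃ N`. -/
noncomputable def lid : BalancedTensor A A N ≃+ N :=
  AddMonoidHom.toAddEquiv
    (lift (· • ·) add_smul smul_add fun x a y => mul_smul x a y)
    (mkRight ℤ (1 : A)).toAddMonoidHom
    (hom_ext A fun a y => by
      change tmul A 1 (a • y) = tmul A a y
      rw [← smul_tmul, op_smul_eq_mul, one_mul])
    (AddMonoidHom.ext fun y => one_smul A y)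

/-- The action isomorphism `M ⊗_A A ≃ M`. -/
noncomputable def rid : BalancedTensor A M A ≃+ M :=
  AddMonoidHom.toAddEquiv
    (lift (fun x a => op a • x) (fun x x' a => smul_add (op a) x x')
      (fun x a b => add_smul (op a) (op b) x) fun x a b => (mul_smul (op b) (op a) x).symm)
    (mkLeft ℤ (1 : A)).toAddMonoidHom
    (hom_ext A fun x a => by
      change tmul A (op a • x) 1 = tmul A x a
      rw [smul_tmul, smul_eq_mul, mul_one])
    (AddMonoidHom.ext fun x => one_smul Aᵐᵒᵖ x)

variable {M N} {S : Type*} [Ring S]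

theorem lid_smul_of_left (s : A) (t : BalancedTensor A A N) :
    lid A N (s • t) = s • lid A N t :=
  map_smul_of_tmul (lid A N).toAddMonoidHom (fun a b y => mul_smul a b y) s t

theorem lid_smul_of_right [Module S N] [SMulCommClass S A N] (s : S) (t : BalancedTensor A A N) :
    lid A N (s • t) = s • lid A N t :=
  map_smul_of_tmul (S := S) (lid A N).toAddMonoidHom (fun s a y => (smul_comm s a y).symm) s t

theorem rid_smul_of_left [Module S M] [SMulCommClass S Aᵐᵒᵖ M] (s : S)
    (t : BalancedTensor A M A) : rid A M (s • t) = s • rid A M t :=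
  map_smul_of_tmul (S := S) (rid A M).toAddMonoidHom (fun s x a => (smul_comm s (op a) x).symm) s t

theorem rid_smul_of_right (s : Aᵐᵒᵖ) (t : BalancedTensor A M A) :
    rid A M (s • t) = s • rid A M t :=
  map_smul_of_tmul (rid A M).toAddMonoidHom (fun s x a => mul_smul s (op a) x) s t

end Unit

end BalancedTensor

/-! ### Tensor products of almost isomorphisms, and the condition `γ` -/

section TensorAlmostIso

variable {K : Type v} [CommRing K] {δ : DimFunction.{v, u} K} {n : EReal} {A S : Type u} [Ring A]
  [Ring S] [Algebra K S] {X Y Z : Type u} [AddCommGroup X] [Module Aᵐᵒᵖ X]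
  [AddCommGroup Y] [Module A Y] [Module S Y] [SMulCommClass S A Y]
  [AddCommGroup Z] [Module A Z] [Module S Z] [SMulCommClass S A Z]

open BalancedTensor

attribute [local instance] leftModule rightModule

namespace IsAlmostIso

theorem mapRight_coker_le (hδ : IsExactDimension δ S) [Module.Finite Aᵐᵒᵖ X] {f : Y →ₗ[S] Z}
    (hf : ∀ (a : A) y, f (a • y) = a • f y) (h : δ S (Z ⧸ LinearMap.range f) ≤ n) :
    δ S (BalancedTensor A X Z ⧸
      LinearMap.range (mapRight (LinearMap.id : X →ₗ[Aᵐᵒᵖ] X) f hf)) ≤ n := by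
  obtain ⟨k, π, hπ⟩ := Module.Finite.exists_fin' Aᵐᵒᵖ X
  set T := LinearMap.range (mapRight (LinearMap.id : X →ₗ[Aᵐᵒᵖ] X) f hf)
  let g (i : Fin k) : (Z ⧸ LinearMap.range f) →ₗ[S] (BalancedTensor A X Z ⧸ T) :=
    (LinearMap.range f).mapQ T (mkRight S (π (Pi.single i 1))) (by
      rintro _ ⟨y, rfl⟩
      exact ⟨tmul A _ y, rfl⟩)
  refine hδ.le_of_surjective (f := LinearMap.lsum S _ ℕ g) (fun t => ?_) (hδ.pi_le h k)
  obtain ⟨t, rfl⟩ := Submodule.Quotient.mk_surjective _ t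
  obtain ⟨t, rfl⟩ := map_surjective (g := LinearMap.id) hπ Function.surjective_id t
  obtain ⟨z, rfl⟩ := (piTensorEquiv S A Z k).symm.surjective t
  refine ⟨fun i => Submodule.Quotient.mk (z i), ?_⟩
  rw [LinearMap.lsum_apply, LinearMap.sum_apply]
  exact (map_sum (T.mkQ ∘ₗ rTensor S Z π) (fun i => tmul A (Pi.single i 1) (z i)) _).symm

theorem mapRight_pi_ker_le (hδ : IsExactDimension δ S) (k : ℕ) {f : Y →ₗ[S] Z}
    (hf : ∀ (a : A) y, f (a • y) = a • f y) (h : δ S (LinearMap.ker f) ≤ n) :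
    δ S (LinearMap.ker (mapRight (LinearMap.id : (Fin k → Aᵐᵒᵖ) →ₗ[Aᵐᵒᵖ] _) f hf)) ≤ n := by
  let coord (i : Fin k) := LinearMap.proj i ∘ₗ (piTensorEquiv S A Y k).toLinearMap
  have hcoord : ∀ i, ∀ t ∈ LinearMap.ker (mapRight LinearMap.id f hf),
      coord i t ∈ LinearMap.ker f := fun i t ht =>
    (piTensorEquiv_mapRight S f hf t i).symm.trans (by rw [ht, map_zero, Pi.zero_apply])
  refine hδ.le_of_injective
    (f := LinearMap.pi fun i => (coord i).restrict (hcoord i)) (fun t t' htt => ?_) (hδ.pi_le h k)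
  refine Subtype.ext ((piTensorEquiv S A Y k).injective (funext fun i => ?_))
  exact congrArg Subtype.val (congrFun htt i)

theorem mapRight [IsNoetherianRing Aᵐᵒᵖ] (hδ : IsExactDimension δ S) [Module.Finite Aᵐᵒᵖ X]
    {f : Y →ₗ[S] Z} (hf : ∀ (a : A) y, f (a • y) = a • f y) (h : IsAlmostIso δ n f) :
    IsAlmostIso δ n (BalancedTensor.mapRight (LinearMap.id : X →ₗ[Aᵐᵒᵖ] X) f hf) where
  ker_le := by
    obtain ⟨k, π, hπ⟩ := Module.Finite.exists_fin' Aᵐᵒᵖ X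
    have hexact : Function.Exact (LinearMap.ker π).subtype π := LinearMap.exact_subtype_ker_map π
    refine hδ.ker_le_of_four_lemma (v₁ := rTensor S Y π) (v₂ := rTensor S Z π)
      (u₁ := rTensor S Y (LinearMap.ker π).subtype) (u₂ := rTensor S Z (LinearMap.ker π).subtype)
      (map_surjective hπ Function.surjective_id) ?_ (fun t => (map_exact hexact hπ t).1)
      (linearMap_ext fun _ _ => rfl) (linearMap_ext fun _ _ => rfl)
      (mapRight_coker_le hδ hf h.coker_le) (mapRight_pi_ker_le hδ k hf h.ker_le)
    rw [← rTensor_comp, hexact.linearMap_comp_eq_zero, rTensor_zero]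
  coker_le := mapRight_coker_le hδ hf h.coker_le

end IsAlmostIso

end TensorAlmostIso

section Tor

open BalancedTensor

attribute [local instance] leftModule rightModule

section Presentation

variable {R : Type u} [Ring R]

theorem exists_surjective_homology_ker (S : ShortComplex (ModuleCat.{u} R)) {L : Type u}
    [AddCommGroup L] [Module R L] (p : S.X₂ →ₗ[R] L) (ι : L →ₗ[R] S.X₃)
    (hp : Function.Surjective p) (hι : ι ∘ₗ p = S.g.hom) (hf : p ∘ₗ S.f.hom = 0) :
    ∃ q : S.homology →ₗ[R] LinearMap.ker ι, Function.Surjective q := by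
  let e := S.moduleCatHomologyIso.toLinearEquiv
  have hιp : ∀ t, ι (p t) = S.g.hom t := LinearMap.congr_fun hι
  let p' : LinearMap.ker S.g.hom →ₗ[R] LinearMap.ker ι := p.restrict fun t ht => (hιp t).trans ht
  let q : (LinearMap.ker S.g.hom ⧸ LinearMap.range S.moduleCatToCycles) →ₗ[R] LinearMap.ker ι :=
    Submodule.liftQ _ p' (by
      rintro _ ⟨t, rfl⟩
      exact Subtype.ext (LinearMap.congr_fun hf t))
  refine ⟨q ∘ₗ e.toLinearMap, Function.Surjective.comp (g := q) ?_ e.surjective⟩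
  rintro ⟨s, hs⟩
  obtain ⟨t, rfl⟩ := hp s
  exact ⟨Submodule.Quotient.mk ⟨t, (hιp t).symm.trans hs⟩, rfl⟩

variable {Y F : Type u} [AddCommGroup Y] [Module R Y] [AddCommGroup F] [Module R F]

/- `Y` is the pushout of `I ← ker π → F`, where the left arrow is induced by a lift of `π`. -/
theorem exists_exact_prod_coprod_of_projective [Module.Projective R F] (I : Submodule R Y)
    {π : F →ₗ[R] Y ⧸ I} (hπ : Function.Surjective π) :
    ∃ (l : LinearMap.ker π →ₗ[R] I) (s : F →ₗ[R] Y),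
      Function.Exact (l.prod (LinearMap.ker π).subtype) (I.subtype.coprod s) ∧
        Function.Surjective (I.subtype.coprod s) := by
  obtain ⟨s, hs⟩ := Module.projective_lifting_property I.mkQ π I.mkQ_surjective
  have hs' : ∀ x, Submodule.Quotient.mk (s x) = π x := LinearMap.congr_fun hs
  have hsker : ∀ x ∈ LinearMap.ker π, s x ∈ I := fun x hx => by
    rw [← Submodule.Quotient.mk_eq_zero, hs', hx]
  refine ⟨-s.restrict hsker, s, fun z => ⟨fun hz => ?_, ?_⟩, fun y => ?_⟩
  · have hz' : (z.1 : Y) + s z.2 = 0 := hz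
    have hker : π z.2 = 0 := by
      rw [← hs', Submodule.Quotient.mk_eq_zero, ← neg_eq_of_add_eq_zero_right hz']
      exact I.neg_mem z.1.2
    exact ⟨⟨z.2, hker⟩, Prod.ext (Subtype.ext (eq_neg_of_add_eq_zero_left hz').symm) rfl⟩
  · rintro ⟨x, rfl⟩
    exact neg_add_cancel (s x)
  · obtain ⟨x, hx⟩ := hπ (Submodule.Quotient.mk y)
    have hmem : y - s x ∈ I := by rw [← Submodule.Quotient.eq, hs', hx]
    exact ⟨(⟨_, hmem⟩, x), sub_add_cancel y (s x)⟩

end Presentation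

theorem exists_ker_rTensor_subtype_le_map {A S Y F N : Type u} [Ring A] [Ring S] [AddCommGroup Y]
    [Module Aᵐᵒᵖ Y] [AddCommGroup F] [Module Aᵐᵒᵖ F] [AddCommGroup N] [Module A N] [Module S N]
    [SMulCommClass S A N] [Module.Projective Aᵐᵒᵖ F] (I : Submodule Aᵐᵒᵖ Y)
    {π : F →ₗ[Aᵐᵒᵖ] Y ⧸ I} (hπ : Function.Surjective π) :
    ∃ l : LinearMap.ker π →ₗ[Aᵐᵒᵖ] I, LinearMap.ker (rTensor S N I.subtype) ≤
      (LinearMap.ker (rTensor S N (LinearMap.ker π).subtype)).map (rTensor S N l) := by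
  obtain ⟨l, s, hexact, hsurj⟩ := exists_exact_prod_coprod_of_projective I hπ
  refine ⟨l, fun t ht => ?_⟩
  have hinl : rTensor S N (I.subtype.coprod s) (rTensor S N (LinearMap.inl Aᵐᵒᵖ I F) t) = 0 := by
    rw [← LinearMap.comp_apply, ← rTensor_comp, LinearMap.coprod_inl]
    exact ht
  obtain ⟨κ, hκ : rTensor S N (l.prod (LinearMap.ker π).subtype) κ =
    rTensor S N (LinearMap.inl Aᵐᵒᵖ I F) t⟩ := (map_exact hexact hsurj _).1 hinl
  have hproj {G : Type u} [AddCommGroup G] [Module Aᵐᵒᵖ G] (p : I × F →ₗ[Aᵐᵒᵖ] G) :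
      rTensor S N (p ∘ₗ l.prod (LinearMap.ker π).subtype) κ =
        rTensor S N (p ∘ₗ LinearMap.inl Aᵐᵒᵖ I F) t := by
    simp only [rTensor_comp, LinearMap.comp_apply, hκ]
  refine ⟨κ, ?_, ?_⟩
  · have hsnd := hproj (LinearMap.snd Aᵐᵒᵖ I F)
    rwa [LinearMap.snd_prod, LinearMap.snd_comp_inl, rTensor_zero] at hsnd
  · have hfst := hproj (LinearMap.fst Aᵐᵒᵖ I F)
    rw [LinearMap.fst_prod, LinearMap.fst_comp_inl] at hfst
    exact hfst.trans (DFunLike.congr_fun (BalancedTensor.map_id A) t)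

variable {K : Type v} [CommRing K] {A B : Type u} [Ring A] [Algebra K A] [Ring B] [Algebra K B]

namespace CentralBimodule

instance preservesFiniteColimits_tensorRight (N : CentralBimodule K A B) :
    Limits.PreservesFiniteColimits (tensorRight N) := by
  refine ((tensorRight N).preservesFiniteColimits_tfae.out 0 3 :).1 fun S hS => ⟨?_, ?_⟩
  · rw [ShortComplex.moduleCat_exact_iff]
    exact fun t => (map_exact
      ((ShortComplex.ShortExact.moduleCat_exact_iff_function_exact S).1 hS.exact)
      hS.moduleCat_surjective_g t).1
  · rw [ModuleCat.epi_iff_surjective]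
    exact map_surjective hS.moduleCat_surjective_g Function.surjective_id

theorem exists_presentation_torRight (N : CentralBimodule K A B) (Z : ModuleCat.{u} Aᵐᵒᵖ) :
    ∃ (F : ModuleCat.{u} Aᵐᵒᵖ) (π : F →ₗ[Aᵐᵒᵖ] Z), Module.Projective Aᵐᵒᵖ F ∧
      Function.Surjective π ∧ ∃ q : N.torRight 1 Z →ₗ[Bᵐᵒᵖ]
        LinearMap.ker (rTensor Bᵐᵒᵖ N (LinearMap.ker π).subtype), Function.Surjective q := by
  obtain ⟨P⟩ := (inferInstance : HasProjectiveResolution Z).out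
  let π : P.complex.X 0 →ₗ[Aᵐᵒᵖ] Z := (P.π.f 0).hom
  let d : P.complex.X 1 →ₗ[Aᵐᵒᵖ] LinearMap.ker π :=
    (P.complex.d 1 0).hom.codRestrict _ fun x =>
      LinearMap.congr_fun (congrArg ModuleCat.Hom.hom P.complex_d_comp_π_f_zero) x
  have hd : Function.Surjective d := by
    rintro ⟨x, hx⟩
    obtain ⟨y, hy⟩ := (ShortComplex.moduleCat_exact_iff _).1 P.exact₀ x hx
    exact ⟨y, Subtype.ext hy⟩
  have hdd : d ∘ₗ (P.complex.d 2 1).hom = 0 := by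
    ext x
    exact LinearMap.congr_fun (congrArg ModuleCat.Hom.hom (P.complex.d_comp_d 2 1 0)) x
  let T := ((tensorRight N).mapHomologicalComplex (ComplexShape.down ℕ)).obj P.complex
  let e := (P.isoLeftDerivedObj (tensorRight N) 1 ≪≫
    T.homologyIsoSc' 2 1 0 (by simp) (by simp)).toLinearEquiv
  obtain ⟨q, hq⟩ := exists_surjective_homology_ker (T.sc' 2 1 0) (rTensor Bᵐᵒᵖ N d)
    (rTensor Bᵐᵒᵖ N (LinearMap.ker π).subtype) (map_surjective hd Function.surjective_id)
    (linearMap_ext fun _ _ => rfl)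
    ((rTensor_comp _ _).symm.trans ((congrArg (rTensor Bᵐᵒᵖ N) hdd).trans rTensor_zero))
  exact ⟨P.complex.X 0, π, (IsProjective.iff_projective _).2 (P.projective 0),
    (ModuleCat.epi_iff_surjective _).1 (inferInstanceAs (Epi (P.π.f 0))),
    q ∘ₗ e.toLinearMap, hq.comp e.surjective⟩

end CentralBimodule

variable {δ : DimFunction.{v, u} K} {n : EReal} {X Y : Type u} [AddCommGroup X] [Module Aᵐᵒᵖ X]
  [AddCommGroup Y] [Module Aᵐᵒᵖ Y] {N : CentralBimodule K A B}

namespace GammaCondition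

theorem tensor_le (hγ : GammaCondition δ n 1 A B) (hδ : IsExactDimension δ Bᵐᵒᵖ) (hN : N.IsFG)
    [Module.Finite Aᵐᵒᵖ X] (hX : δ Aᵐᵒᵖ X ≤ n) : δ Bᵐᵒᵖ (BalancedTensor A X N) ≤ n := by
  have e := (N.tensorRight.leftDerivedZeroIsoSelf.app (ModuleCat.of Aᵐᵒᵖ X)).toLinearEquiv
  exact hδ.le_of_surjective (f := e.toLinearMap) e.surjective
    ((hγ N hN).1 _ ⟨‹_›, hX⟩ 0 zero_le_one).2

theorem ker_rTensor_subtype_le (hγ : GammaCondition δ n 1 A B) (hδ : IsExactDimension δ Bᵐᵒᵖ)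
    (hN : N.IsFG) [Module.Finite Aᵐᵒᵖ Y] (I : Submodule Aᵐᵒᵖ Y) (hI : δ Aᵐᵒᵖ (Y ⧸ I) ≤ n) :
    δ Bᵐᵒᵖ (LinearMap.ker (rTensor Bᵐᵒᵖ N I.subtype)) ≤ n := by
  obtain ⟨F, π, _, hπ, q, hq⟩ := N.exists_presentation_torRight (ModuleCat.of Aᵐᵒᵖ (Y ⧸ I))
  obtain ⟨l, hl⟩ := exists_ker_rTensor_subtype_le_map (S := Bᵐᵒᵖ) (N := N) I hπ
  have hfin : Module.Finite Aᵐᵒᵖ (Y ⧸ I) := inferInstance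
  exact hδ.submodule_mono hl (hδ.submodule_map_le _
    (hδ.le_of_surjective hq ((hγ N hN).1 _ ⟨hfin, hI⟩ 1 le_rfl).2))

end GammaCondition

namespace IsAlmostIso

theorem rTensor_of_surjective [IsNoetherianRing Aᵐᵒᵖ] (hγ : GammaCondition δ n 1 A B)
    (hδ : IsExactDimension δ Bᵐᵒᵖ) (hN : N.IsFG) [Module.Finite Aᵐᵒᵖ X] {f : X →ₗ[Aᵐᵒᵖ] Y}
    (hf : Function.Surjective f) (hker : δ Aᵐᵒᵖ (LinearMap.ker f) ≤ n) :
    IsAlmostIso δ n (BalancedTensor.rTensor Bᵐᵒᵖ N f) where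
  ker_le := hδ.submodule_mono
    (fun t ht => (map_exact (LinearMap.exact_subtype_ker_map f) hf t).1 ht)
    (hδ.range_le (BalancedTensor.rTensor Bᵐᵒᵖ N (LinearMap.ker f).subtype)
      (hγ.tensor_le hδ hN hker))
  coker_le := by
    rw [LinearMap.range_eq_top.2 (map_surjective hf Function.surjective_id)]
    exact hδ.le_of_subsingleton

theorem rTensor_subtype (hγ : GammaCondition δ n 1 A B) (hδ : IsExactDimension δ Bᵐᵒᵖ)
    (hN : N.IsFG) [Module.Finite Aᵐᵒᵖ Y] (I : Submodule Aᵐᵒᵖ Y) (hI : δ Aᵐᵒᵖ (Y ⧸ I) ≤ n) :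
    IsAlmostIso δ n (BalancedTensor.rTensor Bᵐᵒᵖ N I.subtype) where
  ker_le := hγ.ker_rTensor_subtype_le hδ hN I hI
  coker_le := by
    have hexact : Function.Exact (BalancedTensor.rTensor Bᵐᵒᵖ N I.subtype)
        (BalancedTensor.rTensor Bᵐᵒᵖ N I.mkQ) :=
      map_exact (LinearMap.exact_subtype_mkQ I) I.mkQ_surjective
    rw [← hexact.linearMap_ker_eq, hδ.congr _ _ (LinearMap.quotKerEquivRange _)]
    exact hδ.le_of_injective (Submodule.injective_subtype _) (hγ.tensor_le hδ hN hI)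

theorem rTensor [IsNoetherianRing Aᵐᵒᵖ] (hγ : GammaCondition δ n 1 A B)
    (hδ : IsExactDimension δ Bᵐᵒᵖ) (hN : N.IsFG) [Module.Finite Aᵐᵒᵖ X] [Module.Finite Aᵐᵒᵖ Y]
    {f : X →ₗ[Aᵐᵒᵖ] Y} (hf : IsAlmostIso δ n f) :
    IsAlmostIso δ n (BalancedTensor.rTensor Bᵐᵒᵖ N f) := by
  have hcomp := (rTensor_subtype hγ hδ hN (LinearMap.range f) hf.coker_le).comp hδ
    (rTensor_of_surjective hγ hδ hN f.surjective_rangeRestrict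
      ((LinearMap.ker_rangeRestrict f).symm ▸ hf.ker_le))
  rwa [← rTensor_comp] at hcomp

end IsAlmostIso

end Tor

/-! ### `Ext` and projective dimension -/

section LinearMap

variable {R S X Y Z D : Type*} [Ring R] [Ring S] [AddCommGroup X] [Module R X] [AddCommGroup Y]
  [Module R Y] [AddCommGroup Z] [Module R Z] [AddCommGroup D] [Module R D]

theorem exists_comp_eq_of_ker_le_ker {f : X →ₗ[R] Y} (hf : Function.Surjective f) {g : X →ₗ[R] D}
    (h : LinearMap.ker f ≤ LinearMap.ker g) : ∃ k : Y →ₗ[R] D, k ∘ₗ f = g := by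
  refine ⟨(LinearMap.ker f).liftQ g h ∘ₗ (f.quotKerEquivOfSurjective hf).symm.toLinearMap,
    LinearMap.ext fun x => ?_⟩
  have : (f.quotKerEquivOfSurjective hf).symm (f x) = Submodule.Quotient.mk x :=
    (LinearEquiv.symm_apply_eq _).2 rfl
  rw [LinearMap.comp_apply, LinearMap.comp_apply, LinearEquiv.coe_coe, this]
  rfl

theorem exact_lcomp [Module S D] [SMulCommClass R S D] {f : X →ₗ[R] Y} {g : Y →ₗ[R] Z}
    (h : Function.Exact f g) (hg : Function.Surjective g) :
    Function.Exact (LinearMap.lcomp S D g) (LinearMap.lcomp S D f) := by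
  intro k
  refine ⟨fun hk => ?_, ?_⟩
  · refine exists_comp_eq_of_ker_le_ker hg ?_
    rw [h.linearMap_ker_eq]
    exact LinearMap.range_le_ker_iff.2 hk
  · rintro ⟨k, rfl⟩
    exact LinearMap.ext fun x => (congrArg k (h.apply_apply_eq_zero x)).trans (map_zero k)

theorem lcomp_injective [Module S D] [SMulCommClass R S D] {g : Y →ₗ[R] Z}
    (hg : Function.Surjective g) : Function.Injective (LinearMap.lcomp S D g) :=
  fun _ _ h => (LinearMap.cancel_right hg).1 h

theorem projective_pi [Module.Projective R X] {ι : Type*} [Finite ι] :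
    Module.Projective R (ι → X) := by
  classical
  have := Fintype.ofFinite ι
  exact Module.Projective.of_equiv (DFinsupp.linearEquivFunOnFintype (R := R) (M := fun _ : ι => X))

/-- A ring as a right module over itself, compared with its opposite as a left module over
itself. -/
def unopLinearEquiv (R : Type*) [Ring R] : Rᵐᵒᵖ ≃ₗ[Rᵐᵒᵖ] R where
  toFun := unop
  map_add' _ _ := rfl
  map_smul' _ _ := rfl
  invFun := op
  left_inv _ := rfl
  right_inv _ := rfl

instance : Module.Projective Rᵐᵒᵖ R := Module.Projective.of_equiv (unopLinearEquiv R)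

instance : Module.Finite Rᵐᵒᵖ R := Module.Finite.equiv (unopLinearEquiv R)

theorem exists_retract_pi [Module.Finite R X] [Module.Projective R X] (e : R ≃ₗ[R] D) :
    ∃ (k : ℕ) (i : X →ₗ[R] (Fin k → D)) (r : (Fin k → D) →ₗ[R] X), r ∘ₗ i = LinearMap.id := by
  obtain ⟨k, r, i, -, -, hri⟩ := Module.Finite.exists_comp_eq_id_of_projective R X
  let e' : (Fin k → R) ≃ₗ[R] (Fin k → D) := LinearEquiv.piCongrRight fun _ => e
  refine ⟨k, e'.toLinearMap ∘ₗ i, r ∘ₗ e'.symm.toLinearMap, LinearMap.ext fun x => ?_⟩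
  simpa using LinearMap.congr_fun hri x

end LinearMap

section Ext

open Abelian

variable {R : Type u} [Ring R] {X Y Z D : Type u} [AddCommGroup X] [Module R X]
  [AddCommGroup Y] [Module R Y] [AddCommGroup Z] [Module R Z] [AddCommGroup D] [Module R D]

theorem le_gradeNumber_iff {q : ℕ} :
    (q : ℕ∞) ≤ gradeNumber R D X ↔ ∀ i < q, Subsingleton (ExtTo R D X i) := by
  refine le_sInf_iff.trans ⟨fun h i hi => ?_, ?_⟩
  · by_contra hn
    exact hi.not_ge (by exact_mod_cast h i ⟨i, rfl, not_subsingleton_iff_nontrivial.1 hn⟩)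
  · rintro h _ ⟨i, rfl, hi⟩
    by_contra hlt
    exact not_subsingleton_iff_nontrivial.2 hi (h i (by exact_mod_cast not_le.1 hlt))

theorem subsingleton_extTo_of_subsingleton [Subsingleton X] (i : ℕ) :
    Subsingleton (ExtTo R D X i) := by
  have := (ModuleCat.isZero_of_subsingleton (ModuleCat.of R X)).hasProjectiveDimensionLT_zero
  exact subsingleton_of_forall_eq 0 fun e =>
    Ext.eq_zero_of_hasProjectiveDimensionLT e 0 (Nat.zero_le i)

theorem subsingleton_extTo_zero_iff :
    Subsingleton (ExtTo R D X 0) ↔ ∀ f : X →ₗ[R] D, f = 0 := by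
  rw [← (Equiv.ofBijective _ (Ext.mk₀_bijective (ModuleCat.of R X)
    (ModuleCat.of R D))).subsingleton_congr, ModuleCat.homEquiv.subsingleton_congr]
  exact ⟨fun _ f => Subsingleton.elim f 0, subsingleton_of_forall_eq 0⟩

variable {f : X →ₗ[R] Y} {g : Y →ₗ[R] Z}

theorem shortExact_moduleCat (h : Function.Exact f g) (hf : Function.Injective f)
    (hg : Function.Surjective g) :
    (ModuleCat.shortComplexOfCompEqZero f g h.linearMap_comp_eq_zero).ShortExact :=
  ModuleCat.shortComplex_shortExact _ h hf hg

/-- The connecting homomorphism `Hom(X, D) → Ext¹(Z, D)` of a short exact sequence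
`0 → X → Y → Z → 0`, linear over every ring `S` acting on `D` by `R`-linear maps. -/
noncomputable def extConnecting (S : Type u) [Ring S] [Module S D] [SMulCommClass S R D]
    [SMulCommClass R S D] (h : Function.Exact f g) (hf : Function.Injective f)
    (hg : Function.Surjective g) : (X →ₗ[R] D) →ₗ[S] ExtTo R D Z 1 where
  toFun k := (shortExact_moduleCat h hf hg).extClass.comp (Ext.mk₀ (ModuleCat.ofHom k))
    (add_zero 1)
  map_add' k k' := by
    rw [← Ext.comp_add, ← Ext.mk₀_add]
    rfl
  map_smul' s k := by
    change _ = ((shortExact_moduleCat h hf hg).extClass.comp (Ext.mk₀ (ModuleCat.ofHom k))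
      (add_zero 1)).comp
        (Ext.mk₀ (ModuleCat.ofHom (Module.toModuleEnd R (S := S) D s))) (add_zero 1)
    rw [Ext.comp_assoc_of_third_deg_zero, Ext.mk₀_comp_mk₀]
    rfl

theorem exists_comp_eq_of_extConnecting_eq_zero {S : Type u} [Ring S] [Module S D]
    [SMulCommClass S R D] [SMulCommClass R S D] {h : Function.Exact f g}
    {hf : Function.Injective f} {hg : Function.Surjective g} {k : X →ₗ[R] D}
    (hk : extConnecting S h hf hg k = 0) : ∃ k' : Y →ₗ[R] D, k' ∘ₗ f = k := by
  obtain ⟨y, hy⟩ := Ext.contravariant_sequence_exact₁ (shortExact_moduleCat h hf hg) _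
    (Ext.mk₀ (ModuleCat.ofHom k)) (add_zero 1) hk
  obtain ⟨y, rfl⟩ := (Ext.mk₀_bijective _ _).2 y
  rw [Ext.mk₀_comp_mk₀] at hy
  exact ⟨y.hom, congrArg ModuleCat.Hom.hom ((Ext.mk₀_bijective _ _).1 hy)⟩

theorem exists_comp_eq_of_subsingleton_extTo_one (h : Function.Exact f g)
    (hf : Function.Injective f) (hg : Function.Surjective g) [Subsingleton (ExtTo R D Z 1)]
    (k : X →ₗ[R] D) : ∃ k' : Y →ₗ[R] D, k' ∘ₗ f = k :=
  exists_comp_eq_of_extConnecting_eq_zero (S := Module.End R D) (h := h) (hf := hf) (hg := hg)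
    (Subsingleton.elim _ _)

theorem subsingleton_extTo_one_of_projective [Module.Projective R Y] (h : Function.Exact f g)
    (hf : Function.Injective f) (hg : Function.Surjective g)
    (hX : ∀ k : X →ₗ[R] D, ∃ k' : Y →ₗ[R] D, k' ∘ₗ f = k) : Subsingleton (ExtTo R D Z 1) := by
  have hS := shortExact_moduleCat h hf hg
  have : Projective (ModuleCat.of R Y) := (IsProjective.iff_projective Y).1 inferInstance
  refine subsingleton_of_forall_eq 0 fun z => ?_
  obtain ⟨x, rfl⟩ := Ext.contravariant_sequence_exact₃ hS _ z
    ((Ext.mk₀ _).comp z (zero_add 1)).eq_zero_of_projective (add_zero 1)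
  obtain ⟨x, rfl⟩ := (Ext.mk₀_bijective _ _).2 x
  obtain ⟨k', hk'⟩ := hX x.hom
  have hx : x = ModuleCat.ofHom f ≫ ModuleCat.ofHom k' := ModuleCat.hom_ext hk'.symm
  rw [hx, ← Ext.mk₀_comp_mk₀]
  exact hS.extClass_comp_assoc _

theorem subsingleton_extTo_of_extTo_succ [Module.Projective R Y] (h : Function.Exact f g)
    (hf : Function.Injective f) (hg : Function.Surjective g) {k : ℕ}
    [Subsingleton (ExtTo R D Z (k + 2))] : Subsingleton (ExtTo R D X (k + 1)) := by
  have : Projective (ModuleCat.of R Y) := (IsProjective.iff_projective Y).1 inferInstance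
  refine subsingleton_of_forall_eq 0 fun x => ?_
  obtain ⟨y, rfl⟩ := Ext.contravariant_sequence_exact₁ (shortExact_moduleCat h hf hg) _ x
    (n₁ := k + 2) (by omega) (Subsingleton.elim (α := ExtTo R D Z (k + 2)) _ _)
  rw [y.eq_zero_of_projective, Ext.comp_zero]

end Ext

section ProjectiveDimension

variable {R : Type u} [Ring R] {X Y D : Type u} [AddCommGroup X] [Module R X] [AddCommGroup Y]
  [Module R Y] [AddCommGroup D] [Module R D]

theorem projective_iff_hasProjectiveDimensionLT :
    Module.Projective R X ↔ HasProjectiveDimensionLT (ModuleCat.of R X) 1 :=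
  (IsProjective.iff_projective X).trans projective_iff_hasProjectiveDimensionLT_one

theorem hasProjectiveDimensionLT_ker_iff [Module.Projective R X] {f : X →ₗ[R] Y}
    (hf : Function.Surjective f) (k : ℕ) :
    HasProjectiveDimensionLT (ModuleCat.of R (LinearMap.ker f)) (k + 1) ↔
      HasProjectiveDimensionLT (ModuleCat.of R Y) (k + 2) :=
  ((shortExact_moduleCat (LinearMap.exact_subtype_ker_map f) (Submodule.subtype_injective _)
    hf).hasProjectiveDimensionLT_X₃_iff k ((IsProjective.iff_projective X).1 ‹_›)).symm

theorem projective_ker_of_hasProjectiveDimensionLT_coker [Module.Projective R X]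
    [Module.Projective R Y] (f : X →ₗ[R] Y)
    (h : HasProjectiveDimensionLT (ModuleCat.of R (Y ⧸ LinearMap.range f)) 3) :
    Module.Projective R (LinearMap.ker f) := by
  rw [← hasProjectiveDimensionLT_ker_iff (Submodule.mkQ_surjective _) 1, Submodule.ker_mkQ] at h
  rw [projective_iff_hasProjectiveDimensionLT, ← LinearMap.ker_rangeRestrict]
  exact (hasProjectiveDimensionLT_ker_iff f.surjective_rangeRestrict 0).2 h

variable [IsNoetherianRing R]

/- The first syzygy is projective, hence a retract of some `D ^ k`, so `Ext¹(X, D) = 0` splits its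
inclusion. -/
theorem projective_of_subsingleton_extTo_one [Module.Finite R X] (e : R ≃ₗ[R] D)
    (hpd : HasProjectiveDimensionLT (ModuleCat.of R X) 2) [Subsingleton (ExtTo R D X 1)] :
    Module.Projective R X := by
  obtain ⟨m, π, hπ⟩ := Module.Finite.exists_fin' R X
  have hF : Module.Projective R (Fin m → R) := projective_pi
  have hK : Module.Projective R (LinearMap.ker π) :=
    projective_iff_hasProjectiveDimensionLT.2 ((hasProjectiveDimensionLT_ker_iff hπ 0).2 hpd)
  have hex := LinearMap.exact_subtype_ker_map π
  obtain ⟨l, i, r, hri⟩ := exists_retract_pi (X := LinearMap.ker π) e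
  choose i' hi' using fun a : Fin l => exists_comp_eq_of_subsingleton_extTo_one hex
    (Submodule.subtype_injective _) hπ (LinearMap.proj a ∘ₗ i)
  have hi : LinearMap.pi i' ∘ₗ (LinearMap.ker π).subtype = i :=
    LinearMap.ext fun x => funext fun a => LinearMap.congr_fun (hi' a) x
  have hsplit : (r ∘ₗ LinearMap.pi i') ∘ₗ (LinearMap.ker π).subtype = LinearMap.id := by
    rw [LinearMap.comp_assoc, hi, hri]
  obtain ⟨-, s, hs⟩ := (hex.split_tfae'.out 1 0 :).1 ⟨hπ, _, hsplit⟩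
  exact Module.Projective.of_split s π hs

theorem hasProjectiveDimensionLT_of_subsingleton_extTo (e : R ≃ₗ[R] D) (k : ℕ)
    [Module.Finite R X] (hpd : HasProjectiveDimensionLT (ModuleCat.of R X) (k + 2))
    [Subsingleton (ExtTo R D X (k + 1))] :
    HasProjectiveDimensionLT (ModuleCat.of R X) (k + 1) := by
  induction k generalizing X with
  | zero =>
    exact projective_iff_hasProjectiveDimensionLT.1 (projective_of_subsingleton_extTo_one e hpd)
  | succ k ih =>
    obtain ⟨m, π, hπ⟩ := Module.Finite.exists_fin' R X
    have : Module.Projective R (Fin m → R) := projective_pi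
    have : Subsingleton (ExtTo R D (LinearMap.ker π) (k + 1)) :=
      subsingleton_extTo_of_extTo_succ (LinearMap.exact_subtype_ker_map π)
        (Submodule.subtype_injective _) hπ
    exact (hasProjectiveDimensionLT_ker_iff hπ k).1
      (ih ((hasProjectiveDimensionLT_ker_iff hπ (k + 1)).2 hpd))

theorem hasProjectiveDimensionLT_of_forall_subsingleton_extTo (e : R ≃ₗ[R] D) {d n : ℕ}
    [Module.Finite R X] (hpd : HasProjectiveDimensionLT (ModuleCat.of R X) n)
    (hext : ∀ q, d < q → Subsingleton (ExtTo R D X q)) :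
    HasProjectiveDimensionLT (ModuleCat.of R X) (d + 1) := by
  obtain hn | hn := le_total n (d + 1)
  · exact hasProjectiveDimensionLT_of_ge _ n _ hn
  · induction n, hn using Nat.le_induction with
    | base => exact hpd
    | succ n hn ih =>
      obtain ⟨k, rfl⟩ := Nat.exists_eq_add_of_le' (Nat.le_of_add_left_le hn)
      have := hext (k + 1) hn
      exact ih (hasProjectiveDimensionLT_of_subsingleton_extTo e k hpd)

end ProjectiveDimension

section Dual

variable {C : Type u} [Ring C]

theorem exists_hasProjectiveDimensionLT (hC : ∃ n : ℕ, globalDim C = n) (X : Type u)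
    [AddCommGroup X] [Module Cᵐᵒᵖ X] :
    ∃ n : ℕ, HasProjectiveDimensionLT (ModuleCat.of Cᵐᵒᵖ X) n := by
  obtain ⟨n, hn⟩ := hC
  refine ⟨n + 1, (projectiveDimension_le_iff _ _).1 (le_trans ?_ hn.le)⟩
  exact le_iSup (fun M : ModuleCat.{u} Cᵐᵒᵖ => projectiveDimension M) (ModuleCat.of Cᵐᵒᵖ X)

instance (k : ℕ) : Module.Finite Cᵐᵒᵖ ((Fin k → C) →ₗ[C] C) :=
  Module.Finite.equiv ((Pi.basisFun C (Fin k)).constr Cᵐᵒᵖ)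

instance (k : ℕ) : Module.Projective Cᵐᵒᵖ ((Fin k → C) →ₗ[C] C) :=
  have : Module.Projective Cᵐᵒᵖ (Fin k → C) := projective_pi
  Module.Projective.of_equiv ((Pi.basisFun C (Fin k)).constr Cᵐᵒᵖ)

instance [IsNoetherianRing Cᵐᵒᵖ] {V : Type u} [AddCommGroup V] [Module C V] [Module.Finite C V] :
    Module.Finite Cᵐᵒᵖ (V →ₗ[C] C) := by
  obtain ⟨k, π, hπ⟩ := Module.Finite.exists_fin' C V
  exact Module.Finite.of_injective _ (lcomp_injective hπ)

/- Dualizing a presentation of `V` exhibits the dual of `V` as a second syzygy. -/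
theorem projective_dual_of_subsingleton_extTo [IsNoetherianRing C] [IsNoetherianRing Cᵐᵒᵖ]
    (hC : ∃ n : ℕ, globalDim C = n)
    (hext : ∀ (X : Type u) [AddCommGroup X] [Module Cᵐᵒᵖ X] [Module.Finite Cᵐᵒᵖ X],
      ∀ q, 2 < q → Subsingleton (ExtTo Cᵐᵒᵖ C X q))
    (V : Type u) [AddCommGroup V] [Module C V] [Module.Finite C V] :
    Module.Projective Cᵐᵒᵖ (V →ₗ[C] C) := by
  obtain ⟨n, π, hπ⟩ := Module.Finite.exists_fin' C V
  obtain ⟨m, σ, hσ⟩ := Module.Finite.exists_fin' C (LinearMap.ker π)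
  have hex : Function.Exact ((LinearMap.ker π).subtype ∘ₗ σ) π := by
    rw [LinearMap.exact_iff, LinearMap.range_comp_of_range_eq_top _ (LinearMap.range_eq_top.2 hσ),
      Submodule.range_subtype]
  let ρ : ((Fin n → C) →ₗ[C] C) →ₗ[Cᵐᵒᵖ] ((Fin m → C) →ₗ[C] C) :=
    LinearMap.lcomp Cᵐᵒᵖ C ((LinearMap.ker π).subtype ∘ₗ σ)
  obtain ⟨k, hk⟩ := exists_hasProjectiveDimensionLT hC (((Fin m → C) →ₗ[C] C) ⧸ LinearMap.range ρ)
  have hker : Module.Projective Cᵐᵒᵖ (LinearMap.ker ρ) :=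
    projective_ker_of_hasProjectiveDimensionLT_coker ρ
      (hasProjectiveDimensionLT_of_forall_subsingleton_extTo (unopLinearEquiv C) hk (hext _))
  rw [LinearMap.exact_iff.1 (exact_lcomp hex hπ)] at hker
  exact Module.Projective.of_equiv
    (LinearEquiv.ofInjective (LinearMap.lcomp Cᵐᵒᵖ C π) (lcomp_injective hπ)).symm

end Dual

/-! ### Closed modules and double duals over Cohen–Macaulay algebras -/

section Closed

variable {K : Type v} [CommRing K] {δ : DimFunction.{v, u} K} {n : EReal} {R : Type u} [Ring R]
  [Algebra K R]

/-- `D` is closed if maps to `D` extend uniquely along almost isomorphisms between finitely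
generated modules. -/
def IsClosedModule (δ : DimFunction.{v, u} K) (n : EReal) (R : Type u) [Ring R] [Algebra K R]
    (D : Type u) [AddCommGroup D] [Module R D] : Prop :=
  ∀ (X Y : Type u) [AddCommGroup X] [Module R X] [AddCommGroup Y] [Module R Y]
    [Module.Finite R X] [Module.Finite R Y] (f : X →ₗ[R] Y), IsAlmostIso δ n f →
      ∀ g : X →ₗ[R] D, ∃! h : Y →ₗ[R] D, h ∘ₗ f = g

namespace IsClosedModule

variable {D D' : Type u} [AddCommGroup D] [Module R D] [AddCommGroup D'] [Module R D']

theorem of_subsingleton_extTo [IsNoetherianRing R]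
    (h : ∀ (T : Type u) [AddCommGroup T] [Module R T] [Module.Finite R T], δ R T ≤ n →
      ∀ i < 2, Subsingleton (ExtTo R D T i)) : IsClosedModule δ n R D := by
  intro X Y _ _ _ _ _ _ f hf g
  have hker : LinearMap.ker f ≤ LinearMap.ker g := by
    have := subsingleton_extTo_zero_iff.1 (h _ hf.ker_le 0 two_pos)
      (g ∘ₗ (LinearMap.ker f).subtype)
    exact fun x hx => LinearMap.congr_fun this ⟨x, hx⟩
  obtain ⟨g', rfl⟩ : ∃ g', g' ∘ₗ f.rangeRestrict = g :=
    exists_comp_eq_of_ker_le_ker f.surjective_rangeRestrict (f.ker_rangeRestrict.trans_le hker)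
  have := h _ hf.coker_le 1 one_lt_two
  obtain ⟨k, rfl⟩ := exists_comp_eq_of_subsingleton_extTo_one
    (LinearMap.exact_subtype_mkQ (LinearMap.range f)) (Submodule.subtype_injective _)
    (Submodule.mkQ_surjective _) g'
  refine ⟨k, rfl, fun k' hk' => sub_eq_zero.1 ?_⟩
  have hrange : LinearMap.range f ≤ LinearMap.ker (k' - k) := by
    rw [LinearMap.range_le_ker_iff, LinearMap.sub_comp, sub_eq_zero]
    exact hk'
  rw [← (LinearMap.range f).liftQ_mkQ (k' - k) hrange,
    subsingleton_extTo_zero_iff.1 (h _ hf.coker_le 0 two_pos) (Submodule.liftQ _ _ hrange),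
    LinearMap.zero_comp]

theorem of_retract_pi (hD : IsClosedModule δ n R D) {k : ℕ} (i : D' →ₗ[R] (Fin k → D))
    (r : (Fin k → D) →ₗ[R] D') (hri : r ∘ₗ i = LinearMap.id) : IsClosedModule δ n R D' := by
  intro X Y _ _ _ _ _ _ f hf g
  choose h hh huniq using fun a => hD X Y f hf (LinearMap.proj a ∘ₗ i ∘ₗ g)
  have hpi : LinearMap.pi h ∘ₗ f = i ∘ₗ g :=
    LinearMap.ext fun x => funext fun a => LinearMap.congr_fun (hh a) x
  refine ⟨r ∘ₗ LinearMap.pi h, ?_, ?_⟩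
  · change (r ∘ₗ LinearMap.pi h) ∘ₗ f = g
    rw [LinearMap.comp_assoc, hpi, ← LinearMap.comp_assoc, hri, LinearMap.id_comp]
  · rintro h' rfl
    have hih' : i ∘ₗ h' = LinearMap.pi h := LinearMap.ext fun y => funext fun a =>
      LinearMap.congr_fun (huniq a (LinearMap.proj a ∘ₗ i ∘ₗ h') rfl) y
    rw [← hih', ← LinearMap.comp_assoc, hri, LinearMap.id_comp]

theorem bijective_of_isAlmostIso (hD : IsClosedModule δ n R D) (hD' : IsClosedModule δ n R D')
    [Module.Finite R D] [Module.Finite R D'] {f : D →ₗ[R] D'} (hf : IsAlmostIso δ n f) :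
    Function.Bijective f := by
  obtain ⟨g, hgf, -⟩ := hD D D' f hf LinearMap.id
  have hfg : f ∘ₗ g = LinearMap.id := by
    refine (hD' D D' f hf f).unique ?_ (LinearMap.id_comp f)
    rw [LinearMap.comp_assoc, hgf, LinearMap.comp_id]
  exact Function.bijective_iff_has_inverse.2
    ⟨g, LinearMap.congr_fun hgf, LinearMap.congr_fun hfg⟩

end IsClosedModule

end Closed

section DoubleDual

variable (C : Type u) [Ring C] (M : Type u) [AddCommGroup M] [Module Cᵐᵒᵖ M]

/-- The double dual of a right `C`-module, a right `C`-module. -/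
abbrev DoubleDual : Type u := (M →ₗ[Cᵐᵒᵖ] C) →ₗ[C] C

/-- The canonical map to the double dual. -/
def doubleDualEval : M →ₗ[Cᵐᵒᵖ] DoubleDual C M where
  toFun m := { toFun := fun f => f m, map_add' := fun _ _ => rfl, map_smul' := fun _ _ => rfl }
  map_add' m m' := by ext f; exact map_add f m m'
  map_smul' c m := by ext f; exact map_smul f c m

variable {C M}

theorem doubleDualEval_apply (m : M) (f : M →ₗ[Cᵐᵒᵖ] C) : doubleDualEval C M m f = f m := rfl

variable {k : ℕ} {π : (Fin k → Cᵐᵒᵖ) →ₗ[Cᵐᵒᵖ] M}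

/-- The values of a functional on the generators of `M` given by `π`. -/
def dualCoord (π : (Fin k → Cᵐᵒᵖ) →ₗ[Cᵐᵒᵖ] M) : (M →ₗ[Cᵐᵒᵖ] C) →ₗ[C] (Fin k → C) where
  toFun f i := f (π (Pi.single i 1))
  map_add' _ _ := rfl
  map_smul' _ _ := rfl

theorem dualCoord_injective (hπ : Function.Surjective π) : Function.Injective (dualCoord π) :=
  fun _ _ h => (LinearMap.cancel_right hπ).1
    (LinearMap.pi_ext' fun i => LinearMap.ext_ring (congrFun h i))

theorem comp_dualCoord (y : (Fin k → C) →ₗ[C] C) : y ∘ₗ dualCoord π =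
    doubleDualEval C M (∑ i, op (y (Pi.single i 1)) • π (Pi.single i (1 : Cᵐᵒᵖ))) := by
  ext f
  have hf : dualCoord π f = ∑ i, f (π (Pi.single i 1)) • Pi.single i (1 : C) := by
    ext j
    simp [dualCoord, Finset.sum_apply, Pi.single_apply]
  rw [LinearMap.comp_apply, hf, map_sum, doubleDualEval_apply, map_sum]
  exact Finset.sum_congr rfl fun i _ => by rw [map_smul, map_smul]; rfl

instance [IsNoetherianRing C] [Module.Finite Cᵐᵒᵖ M] : Module.Finite C (M →ₗ[Cᵐᵒᵖ] C) := by
  obtain ⟨k, π, hπ⟩ := Module.Finite.exists_fin' Cᵐᵒᵖ M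
  exact Module.Finite.of_injective _ (dualCoord_injective hπ)

/- The cokernel of `M → M**` embeds into `Ext¹` of the cokernel of `M* → C ^ k`, whose submodules
have no nonzero functionals. -/
theorem eq_zero_of_comp_doubleDualEval (hAC : AuslanderCondition C Cᵐᵒᵖ C) [Module.Finite Cᵐᵒᵖ M]
    {g : DoubleDual C M →ₗ[Cᵐᵒᵖ] C} (hg : g ∘ₗ doubleDualEval C M = 0) : g = 0 := by
  obtain ⟨k, π, hπ⟩ := Module.Finite.exists_fin' Cᵐᵒᵖ M
  let φ := extConnecting (D := C) Cᵐᵒᵖ (dualCoord π).exact_map_mkQ_range (dualCoord_injective hπ)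
    (Submodule.mkQ_surjective _)
  have hφ : LinearMap.ker φ ≤ LinearMap.ker g := fun x hx => by
    obtain ⟨y, rfl⟩ := exists_comp_eq_of_extConnecting_eq_zero (LinearMap.mem_ker.1 hx)
    rw [LinearMap.mem_ker, comp_dualCoord]
    exact LinearMap.congr_fun hg _
  obtain ⟨g', rfl⟩ := exists_comp_eq_of_ker_le_ker φ.surjective_rangeRestrict
    (φ.ker_rangeRestrict.trans_le hφ)
  have hgrade := le_gradeNumber_iff.1 (hAC _ inferInstance 1 (LinearMap.range φ))
  rw [subsingleton_extTo_zero_iff.1 (hgrade 0 one_pos) g', LinearMap.zero_comp]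

theorem two_le_gradeNumber_coker_doubleDualEval (hAC : AuslanderCondition C Cᵐᵒᵖ C)
    [Module.Finite Cᵐᵒᵖ M] [Module.Projective Cᵐᵒᵖ (DoubleDual C M)] :
    ((2 : ℕ) : ℕ∞) ≤
      gradeNumber Cᵐᵒᵖ C (DoubleDual C M ⧸ LinearMap.range (doubleDualEval C M)) := by
  refine le_gradeNumber_iff.2 fun i hi => ?_
  interval_cases i
  · refine subsingleton_extTo_zero_iff.2 fun f => ?_
    have hf : f ∘ₗ (LinearMap.range (doubleDualEval C M)).mkQ = 0 :=
      eq_zero_of_comp_doubleDualEval hAC (by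
        rw [LinearMap.comp_assoc, LinearMap.range_mkQ_comp, LinearMap.comp_zero])
    exact (LinearMap.cancel_right (Submodule.mkQ_surjective _)).1 hf
  · refine subsingleton_extTo_one_of_projective
      (LinearMap.exact_subtype_mkQ (LinearMap.range (doubleDualEval C M)))
      (Submodule.subtype_injective _) (Submodule.mkQ_surjective _) fun k => ?_
    -- A functional on the image of `M` extends to `M**` by evaluation at its restriction to `M`.
    refine ⟨{ toFun := fun x => x (k ∘ₗ (doubleDualEval C M).rangeRestrict)
              map_add' := fun _ _ => rfl
              map_smul' := fun _ _ => rfl }, ?_⟩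
    ext ⟨_, m, rfl⟩
    rfl

end DoubleDual

section CohenMacaulay

theorem natCast_le_iff_le_sub_of_add_eq {g : ℕ∞} {x : EReal} {d q : ℕ} (hx : 0 ≤ x)
    (h : ((g : ENNReal) : EReal) + x = d) : (q : ℕ∞) ≤ g ↔ x ≤ d - q := by
  have hg : ((g : ENNReal) : EReal) ≤ (d : ENNReal) := (le_add_of_nonneg_right hx).trans h.le
  have hg' : g ≤ d := by exact_mod_cast hg
  lift g to ℕ using ne_top_of_le_ne_top (ENat.natCast_ne_top d) hg'
  have hxd : x ≤ d := (le_add_of_nonneg_left (EReal.coe_ennreal_nonneg _)).trans h.le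
  lift x to ℝ using ⟨ne_top_of_le_ne_top (EReal.natCast_ne_top d) hxd,
    ne_bot_of_le_ne_bot EReal.zero_ne_bot hx⟩
  have h' : (g : ℝ) + x = d := by
    rw [ENat.toENNReal_coe] at h
    exact EReal.coe_eq_coe_iff.1 h
  have hsub : (x : EReal) ≤ d - q ↔ x ≤ (d : ℝ) - q := EReal.coe_le_coe_iff
  rw [hsub, ← h', Nat.cast_le, ← Nat.cast_le (α := ℝ)]
  constructor <;> intro <;> linarith

variable {K : Type v} [CommRing K] {δ : DimFunction.{v, u} K} {C : Type u} [Ring C] [Algebra K C]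

namespace IsDimCM

variable {X : Type u} [AddCommGroup X]

theorem natCast_le_gradeNumber_iff_right (hCM : IsDimCM δ C) (hδ : IsExactDimension δ Cᵐᵒᵖ)
    [Module Cᵐᵒᵖ X] [Module.Finite Cᵐᵒᵖ X] {q : ℕ} :
    (q : ℕ∞) ≤ gradeNumber Cᵐᵒᵖ C X ↔ δ Cᵐᵒᵖ X ≤ δ.alg C - q := by
  obtain h | h := subsingleton_or_nontrivial X
  · exact iff_of_true (le_gradeNumber_iff.2 fun i _ => subsingleton_extTo_of_subsingleton i)
      hδ.le_of_subsingleton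
  · obtain ⟨d, hd⟩ := hCM.1
    have hX := hCM.2.1 X inferInstance h
    rw [hd] at hX ⊢
    refine natCast_le_iff_le_sub_of_add_eq ((hδ.eq_bot_or_nonneg X).resolve_left fun hbot => ?_) hX
    exact not_subsingleton X ((hδ.eq_bot_iff X).1 hbot)

theorem gradeNumber_le_left (hCM : IsDimCM δ C) (hδ : IsExactDimension δ C) {d : ℕ}
    (hd : δ.alg C ≤ d) [Module C X] [Module.Finite C X] [Nontrivial X] :
    gradeNumber C C X ≤ d := by
  have hX : 0 ≤ δ C X := (hδ.eq_bot_or_nonneg X).resolve_left fun hbot =>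
    not_subsingleton X ((hδ.eq_bot_iff X).1 hbot)
  have hle : ((gradeNumber C C X : ENNReal) : EReal) ≤ (d : ENNReal) :=
    (le_add_of_nonneg_right hX).trans ((hCM.2.2 X inferInstance inferInstance).trans_le hd)
  exact_mod_cast hle

theorem isClosedModule_self [IsNoetherianRing Cᵐᵒᵖ] (hCM : IsDimCM δ C)
    (hδ : IsExactDimension δ Cᵐᵒᵖ) : IsClosedModule δ (δ.alg C - 2) Cᵐᵒᵖ C :=
  IsClosedModule.of_subsingleton_extTo fun _ _ _ _ hT =>
    le_gradeNumber_iff.1 ((hCM.natCast_le_gradeNumber_iff_right hδ).2 hT)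

theorem isClosedModule_of_projective [IsNoetherianRing Cᵐᵒᵖ] (hCM : IsDimCM δ C)
    (hδ : IsExactDimension δ Cᵐᵒᵖ) [Module Cᵐᵒᵖ X] [Module.Finite Cᵐᵒᵖ X]
    [Module.Projective Cᵐᵒᵖ X] : IsClosedModule δ (δ.alg C - 2) Cᵐᵒᵖ X := by
  obtain ⟨k, i, r, hri⟩ := exists_retract_pi (X := X) (unopLinearEquiv C)
  exact (hCM.isClosedModule_self hδ).of_retract_pi i r hri

theorem subsingleton_extTo (hCM : IsDimCM δ C) (hAC : AuslanderCondition Cᵐᵒᵖ C C)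
    (hδ : IsExactDimension δ C) {d : ℕ} (hd : δ.alg C ≤ d) [Module Cᵐᵒᵖ X]
    [Module.Finite Cᵐᵒᵖ X] {q : ℕ} (hq : d < q) : Subsingleton (ExtTo Cᵐᵒᵖ C X q) := by
  refine subsingleton_of_forall_eq 0 fun e => ?_
  by_contra he
  have : Nontrivial (Submodule.span C {e}) := Submodule.nontrivial_span_singleton he
  have hqd : (q : ℕ∞) ≤ d := (hAC X inferInstance q (Submodule.span C {e})).trans
    (hCM.gradeNumber_le_left hδ hd)
  exact hq.not_ge (by exact_mod_cast hqd)

theorem projective_dual [IsNoetherianRing C] [IsNoetherianRing Cᵐᵒᵖ] (hCM : IsDimCM δ C)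
    (hAR : IsAuslanderRegular C) (hδ : IsExactDimension δ C) (hd : δ.alg C ≤ 2)
    (V : Type u) [AddCommGroup V] [Module C V] [Module.Finite C V] :
    Module.Projective Cᵐᵒᵖ (V →ₗ[C] C) :=
  projective_dual_of_subsingleton_extTo hAR.1
    (fun _ _ _ _ _ hq => hCM.subsingleton_extTo hAR.2.1 hδ hd hq) V

theorem coker_doubleDualEval_le [IsNoetherianRing C] [IsNoetherianRing Cᵐᵒᵖ] (hCM : IsDimCM δ C)
    (hAR : IsAuslanderRegular C) (hδ : IsExactDimension δ C) (hδ' : IsExactDimension δ Cᵐᵒᵖ)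
    (hd : δ.alg C ≤ 2) {M : Type u} [AddCommGroup M] [Module Cᵐᵒᵖ M] [Module.Finite Cᵐᵒᵖ M] :
    δ Cᵐᵒᵖ (DoubleDual C M ⧸ LinearMap.range (doubleDualEval C M)) ≤ δ.alg C - 2 :=
  have := hCM.projective_dual hAR hδ hd (M →ₗ[Cᵐᵒᵖ] C)
  (hCM.natCast_le_gradeNumber_iff_right hδ').1 (two_le_gradeNumber_coker_doubleDualEval hAR.2.2)

end IsDimCM

end CohenMacaulay

/-! ### Homomorphisms of bimodules and Morita equivalence -/

namespace BalancedTensor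

/-- The isomorphism `M ⊗_A N ≃ M' ⊗_A N` induced by `M ≃ M'`. -/
noncomputable def congrLeft {A M M' : Type u} [Ring A] [AddCommGroup M] [Module Aᵐᵒᵖ M]
    [AddCommGroup M'] [Module Aᵐᵒᵖ M'] (e : M ≃ₗ[Aᵐᵒᵖ] M') (N : Type u) [AddCommGroup N]
    [Module A N] : BalancedTensor A M N ≃+ BalancedTensor A M' N :=
  AddMonoidHom.toAddEquiv (map A e.toLinearMap LinearMap.id) (map A e.symm.toLinearMap LinearMap.id)
    (hom_ext A fun x y => congrArg (tmul A · y) (e.symm_apply_apply x))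
    (hom_ext A fun x y => congrArg (tmul A · y) (e.apply_symm_apply x))

end BalancedTensor

namespace CentralBimodule

open BalancedTensor

attribute [local instance] leftModule rightModule

variable {K : Type v} [CommRing K] {A B C D : Type u} [Ring A] [Algebra K A] [Ring B] [Algebra K B]
  [Ring C] [Algebra K C] [Ring D] [Algebra K D]

/-- Homomorphisms of bimodules: right linear maps that respect the left action. -/
structure Hom (X Y : CentralBimodule K A B) where
  /-- The underlying right linear map. -/
  toLin : X →ₗ[Bᵐᵒᵖ] Y
  map_left : ∀ (a : A) (x : X), toLin (a • x) = a • toLin x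

namespace Hom

variable {X Y Z : CentralBimodule K A B}

/-- The identity homomorphism. -/
def id (X : CentralBimodule K A B) : Hom X X := ⟨LinearMap.id, fun _ _ => rfl⟩

/-- Composition of bimodule homomorphisms. -/
def comp (g : Hom Y Z) (f : Hom X Y) : Hom X Z :=
  ⟨g.toLin ∘ₗ f.toLin, fun a x => (congrArg g.toLin (f.map_left a x)).trans (g.map_left a _)⟩

/-- The inverse of a bijective homomorphism of bimodules. -/
noncomputable def inv (f : Hom X Y) (hf : Function.Bijective f.toLin) : Hom Y X :=
  ⟨(LinearEquiv.ofBijective f.toLin hf).symm.toLinearMap, fun a y => by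
    obtain ⟨x, rfl⟩ := hf.2 y
    have h : ∀ x, (LinearEquiv.ofBijective f.toLin hf).symm (f.toLin x) = x :=
      (LinearEquiv.ofBijective f.toLin hf).symm_apply_apply
    rw [LinearEquiv.coe_coe, h, ← f.map_left, h]⟩

theorem inv_bijective (f : Hom X Y) (hf : Function.Bijective f.toLin) :
    Function.Bijective (f.inv hf).toLin :=
  (LinearEquiv.ofBijective f.toLin hf).symm.bijective

/-- The homomorphism `f ⊗_B N`. -/
noncomputable def rTensor (f : Hom X Y) (N : CentralBimodule K B C) :
    Hom (X.tensor N) (Y.tensor N) where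
  toLin := BalancedTensor.rTensor Cᵐᵒᵖ N f.toLin
  map_left := map_smul_of_tmul (BalancedTensor.rTensor Cᵐᵒᵖ N f.toLin).toAddMonoidHom fun a x y =>
    congrArg (tmul B · y) (f.map_left a x)

/-- The homomorphism `M ⊗_A f`. -/
noncomputable def lTensor (M : CentralBimodule K C A) (f : Hom X Y) :
    Hom (M.tensor X) (M.tensor Y) where
  toLin := mapRight LinearMap.id f.toLin f.map_left
  map_left := map_smul_of_tmul (mapRight LinearMap.id f.toLin f.map_left).toAddMonoidHom
    fun _ _ _ => rfl

/-- The associativity isomorphism `(M ⊗_B N) ⊗_C L → M ⊗_B (N ⊗_C L)`. -/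
noncomputable def assoc (M : CentralBimodule K A B) (N : CentralBimodule K B C)
    (L : CentralBimodule K C D) : Hom ((M.tensor N).tensor L) (M.tensor (N.tensor L)) where
  toLin := { BalancedTensor.assoc B C M N L with map_smul' := assoc_smul_of_right (S := Dᵐᵒᵖ) }
  map_left := assoc_smul_of_left (S := A)

theorem assoc_bijective (M : CentralBimodule K A B) (N : CentralBimodule K B C)
    (L : CentralBimodule K C D) : Function.Bijective (assoc M N L).toLin :=
  (BalancedTensor.assoc B C M N L).bijective

/-- The action isomorphism `A ⊗_A N → N`. -/
noncomputable def lid (N : CentralBimodule K A B) : Hom ((regular K A).tensor N) N where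
  toLin := { BalancedTensor.lid A N with map_smul' := lid_smul_of_right A (S := Bᵐᵒᵖ) }
  map_left := lid_smul_of_left A

theorem lid_bijective (N : CentralBimodule K A B) : Function.Bijective (lid N).toLin :=
  (BalancedTensor.lid A N).bijective

/-- The action isomorphism `M ⊗_B B → M`. -/
noncomputable def rid (M : CentralBimodule K A B) : Hom (M.tensor (regular K B)) M where
  toLin := { BalancedTensor.rid B M with map_smul' := rid_smul_of_right B }
  map_left := rid_smul_of_left (S := A) B

theorem rid_bijective (M : CentralBimodule K A B) : Function.Bijective (rid M).toLin :=
  (BalancedTensor.rid B M).bijective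

end Hom

instance : Module.Finite Bᵐᵒᵖ (regular K B) := inferInstanceAs (Module.Finite Bᵐᵒᵖ B)

instance (M : CentralBimodule K A B) (N : CentralBimodule K B C) [Module.Finite Bᵐᵒᵖ M]
    [Module.Finite Cᵐᵒᵖ N] : Module.Finite Cᵐᵒᵖ (M.tensor N) :=
  finite_right (A := B) (M := M) (N := N) Cᵐᵒᵖ

theorem IsFG.tensor {M : CentralBimodule K A B} {N : CentralBimodule K B C} (hM : M.IsFG)
    (hN : N.IsFG) : (M.tensor N).IsFG :=
  have := hM.1
  have := hM.2
  have := hN.1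
  have := hN.2
  ⟨finite_left (A := B) (M := M) (N := N) (S := A), inferInstance⟩

/-- A right submodule stable under the left action, as a bimodule. -/
def ofSubmodule (M : CentralBimodule K A B) (S : Submodule Bᵐᵒᵖ M)
    (hS : ∀ (a : A), ∀ x ∈ S, a • x ∈ S) : CentralBimodule K A B :=
  letI : SMul A S := ⟨fun a x => ⟨a • x.1, hS a x.1 x.2⟩⟩
  letI : Module A S := Subtype.val_injective.module A S.subtype.toAddMonoidHom fun _ _ => rfl
  { carrier := S
    smulComm := ⟨fun a b x => Subtype.ext (smul_comm a b x.1)⟩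
    towerLeft := ⟨fun k a x => Subtype.ext (smul_assoc k a x.1)⟩
    towerRight := ⟨fun k b x => Subtype.ext (smul_assoc k b x.1)⟩ }

theorem IsFG.ofSubmodule [IsNoetherianRing A] [IsNoetherianRing Bᵐᵒᵖ] {M : CentralBimodule K A B}
    (hM : M.IsFG) (S : Submodule Bᵐᵒᵖ M) (hS : ∀ (a : A), ∀ x ∈ S, a • x ∈ S) :
    (M.ofSubmodule S hS).IsFG := by
  have := hM.1
  have := hM.2
  let i : M.ofSubmodule S hS →ₗ[A] M :=
    { toFun := Subtype.val, map_add' := fun _ _ => rfl, map_smul' := fun _ _ => rfl }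
  exact ⟨.of_injective i Subtype.val_injective, inferInstanceAs (Module.Finite Bᵐᵒᵖ S)⟩

section Morita

variable {P : CentralBimodule K B C} {Q : CentralBimodule K C B}

/-- The isomorphism `P ⊗_C (Q ⊗_B X) ≃ X` induced by an isomorphism of bimodules
`k : P ⊗_C Q → B`. -/
noncomputable def pairingEquiv (k : Hom (P.tensor Q) (regular K B))
    (hk : Function.Bijective k.toLin) (X : Type u) [AddCommGroup X] [Module B X] :
    BalancedTensor C P (BalancedTensor B Q X) ≃ₗ[B] X :=
  let e := ((BalancedTensor.assoc C B P Q X).symm.trans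
    (congrLeft (LinearEquiv.ofBijective k.toLin hk) X)).trans (BalancedTensor.lid B X)
  { e with
    map_smul' := fun b => DFunLike.congr_fun (hom_ext₃'
      (φ := e.toAddMonoidHom.comp (DistribSMul.toAddMonoidHom _ b))
      (ψ := (DistribSMul.toAddMonoidHom X b).comp e.toAddMonoidHom) fun p q x =>
        (congrArg (α := B) (· • x) (k.map_left b (tmul C p q))).trans (mul_smul b _ x)) }

/-- An isomorphism of bimodules `P ⊗_C Q → B` makes `P ⊗_C (Q ⊗_B -)` isomorphic to the
identity. -/
noncomputable def pairingIso (k : Hom (P.tensor Q) (regular K B))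
    (hk : Function.Bijective k.toLin) :
    tensorLeft Q ⋙ tensorLeft P ≅ 𝟭 (ModuleCat.{u} B) :=
  NatIso.ofComponents (fun X => (pairingEquiv k hk X).toModuleIso) fun {X Y} f =>
    ModuleCat.hom_ext <| LinearMap.toAddMonoidHom_injective <| hom_ext₃'
      (φ := ((pairingEquiv k hk Y).toLinearMap ∘ₗ
        ((tensorLeft P).map ((tensorLeft Q).map f)).hom).toAddMonoidHom)
      (ψ := (f.hom ∘ₗ (pairingEquiv k hk X).toLinearMap).toAddMonoidHom)
      fun p q x => (f.hom.map_smul (k.toLin (tmul C p q)) x).symm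

open scoped ModuleCat.Algebra

instance linear_tensorLeft (Q : CentralBimodule K C B) : (tensorLeft Q).Linear K where
  map_smul f r := ModuleCat.hom_ext <| BalancedTensor.linearMap_ext fun q x => by
    change tmul B q (algebraMap K B r • f.hom x) = tmul B (algebraMap K C r • q) (f.hom x)
    rw [← smul_tmul, algebraMap_smul, ← MulOpposite.algebraMap_apply, algebraMap_smul]

theorem isMoritaEquivalent_of_bijective
    (k : Hom (P.tensor Q) (regular K B)) (hk : Function.Bijective k.toLin)
    (l : Hom (Q.tensor P) (regular K C)) (hl : Function.Bijective l.toLin) :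
    IsMoritaEquivalent K B C where
  cond := ⟨{
    eqv := CategoryTheory.Equivalence.mk (tensorLeft Q) (tensorLeft P)
      (pairingIso k hk).symm (pairingIso l hl)
    linear := inferInstanceAs ((tensorLeft Q).Linear K) }⟩

end Morita

end CentralBimodule

/-! ### Almost isomorphisms of bimodules -/

namespace CentralBimodule

open BalancedTensor

attribute [local instance] leftModule rightModule

variable {K : Type v} [CommRing K] {A B C : Type u} [Ring A] [Algebra K A] [Ring B] [Algebra K B]
  [Ring C] [Algebra K C] {δ : DimFunction.{v, u} K} {n : EReal} {X Y Z : CentralBimodule K A B}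

namespace Hom

/-- A homomorphism of bimodules that is an almost isomorphism of the underlying right modules. -/
def IsAlmostIso (δ : DimFunction.{v, u} K) (n : EReal) (f : Hom X Y) : Prop :=
  _root_.IsAlmostIso δ n f.toLin

namespace IsAlmostIso

theorem of_bijective (hδ : IsExactDimension δ Bᵐᵒᵖ) {f : Hom X Y}
    (hf : Function.Bijective f.toLin) : f.IsAlmostIso δ n :=
  _root_.IsAlmostIso.of_bijective hδ hf

theorem comp (hδ : IsExactDimension δ Bᵐᵒᵖ) {g : Hom Y Z} {f : Hom X Y}
    (hg : g.IsAlmostIso δ n) (hf : f.IsAlmostIso δ n) : (g.comp f).IsAlmostIso δ n :=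
  _root_.IsAlmostIso.comp hδ hg hf

theorem rTensor [IsNoetherianRing Bᵐᵒᵖ] (hγ : GammaCondition δ n 1 B C)
    (hδ : IsExactDimension δ Cᵐᵒᵖ) {N : CentralBimodule K B C} (hN : N.IsFG)
    [Module.Finite Bᵐᵒᵖ X] [Module.Finite Bᵐᵒᵖ Y] {f : Hom X Y} (hf : f.IsAlmostIso δ n) :
    (f.rTensor N).IsAlmostIso δ n :=
  _root_.IsAlmostIso.rTensor hγ hδ hN hf

theorem lTensor [IsNoetherianRing Aᵐᵒᵖ] (hδ : IsExactDimension δ Bᵐᵒᵖ)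
    (M : CentralBimodule K C A) [Module.Finite Aᵐᵒᵖ M] {f : Hom X Y} (hf : f.IsAlmostIso δ n) :
    (f.lTensor M).IsAlmostIso δ n :=
  _root_.IsAlmostIso.mapRight (X := M) hδ f.map_left hf

end IsAlmostIso

theorem exists_extension [Module.Finite Bᵐᵒᵖ X] [Module.Finite Bᵐᵒᵖ Y]
    (hZ : IsClosedModule δ n Bᵐᵒᵖ Z) {f : Hom X Y} (hf : f.IsAlmostIso δ n) (g : Hom X Z) :
    ∃ h : Hom Y Z, h.toLin ∘ₗ f.toLin = g.toLin := by
  obtain ⟨h, hh, -⟩ := hZ X Y f.toLin hf g.toLin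
  have hh' : ∀ x, h (f.toLin x) = g.toLin x := LinearMap.congr_fun hh
  -- For `a : A`, both `h ∘ a` and `a ∘ h` extend `a ∘ g` along `f`.
  have hcomm (a : A) : h ∘ₗ Module.toModuleEnd Bᵐᵒᵖ (S := A) Y a =
      Module.toModuleEnd Bᵐᵒᵖ (S := A) Z a ∘ₗ h := by
    refine (hZ X Y f.toLin hf (Module.toModuleEnd Bᵐᵒᵖ (S := A) Z a ∘ₗ g.toLin)).unique ?_ ?_
    · ext x
      change h (a • f.toLin x) = a • g.toLin x
      rw [← f.map_left, hh', g.map_left]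
    · rw [LinearMap.comp_assoc, hh]
  exact ⟨⟨h, fun a => LinearMap.congr_fun (hcomm a)⟩, hh⟩

theorem exists_extension_isAlmostIso (hδ : IsExactDimension δ Bᵐᵒᵖ) [Module.Finite Bᵐᵒᵖ X]
    [Module.Finite Bᵐᵒᵖ Y] (hZ : IsClosedModule δ n Bᵐᵒᵖ Z) {f : Hom X Y}
    (hf : f.IsAlmostIso δ n) {g : Hom X Z} (hg : g.IsAlmostIso δ n) :
    ∃ h : Hom Y Z, h.IsAlmostIso δ n := by
  obtain ⟨h, hh⟩ := exists_extension hZ hf g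
  exact ⟨h, _root_.IsAlmostIso.of_comp hδ hf (hh ▸ hg)⟩

end Hom

theorem exists_finite_of_nIsomorphic (hδ : IsExactDimension δ Bᵐᵒᵖ) [Module.Finite Bᵐᵒᵖ X]
    [Module.Finite Bᵐᵒᵖ Y] (h : NIsomorphic δ n X Y) :
    ∃ (P : CentralBimodule K A B) (f : Hom X P) (g : Hom Y P), Module.Finite Bᵐᵒᵖ P ∧
      f.IsAlmostIso δ n ∧ g.IsAlmostIso δ n := by
  obtain ⟨P, f, g, hf, hg, hf₁, hf₂, hg₁, hg₂⟩ := h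
  let S : Submodule Bᵐᵒᵖ P := LinearMap.range f ⊔ LinearMap.range g
  have hS : ∀ (a : A), ∀ x ∈ S, a • x ∈ S := by
    intro a _ h
    obtain ⟨_, ⟨x, rfl⟩, _, ⟨y, rfl⟩, rfl⟩ := Submodule.mem_sup.1 h
    rw [smul_add, ← hf, ← hg]
    exact Submodule.add_mem_sup ⟨_, rfl⟩ ⟨_, rfl⟩
  have hfS (x) : f x ∈ S := (le_sup_left : _ ≤ S) ⟨x, rfl⟩
  have hgS (y) : g y ∈ S := (le_sup_right : _ ≤ S) ⟨y, rfl⟩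
  refine ⟨P.ofSubmodule S hS, ⟨f.codRestrict S hfS, fun a x => Subtype.ext (hf a x)⟩,
    ⟨g.codRestrict S hgS, fun a y => Subtype.ext (hg a y)⟩, ?_,
    _root_.IsAlmostIso.codRestrict hδ ⟨hf₁, hf₂⟩ hfS,
    _root_.IsAlmostIso.codRestrict hδ ⟨hg₁, hg₂⟩ hgS⟩
  exact inferInstanceAs
    (Module.Finite Bᵐᵒᵖ ↥(LinearMap.range f ⊔ LinearMap.range g : Submodule Bᵐᵒᵖ P))

theorem exists_hom_of_nIsomorphic (hδ : IsExactDimension δ Bᵐᵒᵖ) [Module.Finite Bᵐᵒᵖ X]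
    [Module.Finite Bᵐᵒᵖ Y] (hY : IsClosedModule δ n Bᵐᵒᵖ Y) (h : NIsomorphic δ n X Y) :
    ∃ f : Hom X Y, f.IsAlmostIso δ n := by
  obtain ⟨P, f, g, _, hf, hg⟩ := exists_finite_of_nIsomorphic hδ h
  obtain ⟨r, hr⟩ := Hom.exists_extension_isAlmostIso hδ hY hg (g := Hom.id Y)
    (.of_bijective hδ Function.bijective_id)
  exact ⟨r.comp f, hr.comp hδ hf⟩

theorem exists_pairing [IsNoetherianRing Aᵐᵒᵖ]
    (hδA : IsExactDimension δ Aᵐᵒᵖ) (hδB : IsExactDimension δ Bᵐᵒᵖ) (hγ : GammaCondition δ n 1 A B)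
    (hB : IsClosedModule δ n Bᵐᵒᵖ B) {M₁ : CentralBimodule K B A} {N₁ : CentralBimodule K A B}
    {M₂ : CentralBimodule K C A} {N₂ : CentralBimodule K A C} (hM₁ : M₁.IsFG) (hN₁ : N₁.IsFG)
    (hM₂ : M₂.IsFG) (hN₂ : N₂.IsFG) (h₁ : NIsomorphic δ n (M₁.tensor N₁) (regular K B))
    (h₂ : NIsomorphic δ n (N₂.tensor M₂) (regular K A)) :
    ∃ e : Hom ((M₁.tensor N₂).tensor (M₂.tensor N₁)) (regular K B), e.IsAlmostIso δ n := by
  have := hM₁.2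
  have := hN₁.2
  have := hM₂.2
  have := hN₂.2
  obtain ⟨e, he⟩ := exists_hom_of_nIsomorphic (Y := regular K B) hδB hB h₁
  obtain ⟨P, f, g, _, hf, hg⟩ := exists_finite_of_nIsomorphic hδA h₂
  have sandwich {U V : CentralBimodule K A A} [Module.Finite Aᵐᵒᵖ U] [Module.Finite Aᵐᵒᵖ V]
      {w : Hom U V} (hw : w.IsAlmostIso δ n) : ((w.lTensor M₁).rTensor N₁).IsAlmostIso δ n :=
    (hw.lTensor hδA M₁).rTensor hγ hδB hN₁
  have hrid : ((Hom.rid M₁).rTensor N₁).IsAlmostIso δ n :=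
    Hom.IsAlmostIso.rTensor hγ hδB hN₁ (.of_bijective hδA (Hom.rid_bijective M₁))
  obtain ⟨k, hk⟩ := Hom.exists_extension_isAlmostIso (Z := regular K B) hδB hB (sandwich hg)
    (he.comp hδB hrid)
  have hassoc : ((Hom.assoc M₁ N₂ M₂).rTensor N₁).IsAlmostIso δ n :=
    Hom.IsAlmostIso.rTensor hγ hδB hN₁ (.of_bijective hδA (Hom.assoc_bijective M₁ N₂ M₂))
  have hassoc' := Hom.IsAlmostIso.of_bijective (n := n) hδB
    (Hom.inv_bijective _ (Hom.assoc_bijective (M₁.tensor N₂) M₂ N₁))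
  exact ⟨_, ((hk.comp hδB (sandwich hf)).comp hδB hassoc).comp hδB hassoc'⟩

end CentralBimodule

/-! ### Almost inverse bimodules -/

section AlmostInverse

variable {K : Type v} [CommRing K] {B C : Type u} [Ring B] [Algebra K B] [Ring C] [Algebra K C]
  {δ : DimFunction.{v, u} K} {n : EReal}

open BalancedTensor

attribute [local instance] leftModule rightModule

/-- The ring homomorphism sending an endomorphism of a right `C`-module to its double transpose. -/
def doubleTranspose (C M : Type u) [Ring C] [AddCommGroup M] [Module Cᵐᵒᵖ M] :
    Module.End Cᵐᵒᵖ M →+* Module.End Cᵐᵒᵖ (DoubleDual C M) where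
  toFun f := LinearMap.lcomp Cᵐᵒᵖ C (LinearMap.lcomp C C f)
  map_one' := rfl
  map_mul' _ _ := rfl
  map_zero' := by
    ext x f
    exact (congrArg x (LinearMap.comp_zero f)).trans (map_zero x)
  map_add' g g' := by
    ext x f
    exact (congrArg x (LinearMap.comp_add g g' f)).trans (map_add x _ _)

namespace CentralBimodule

/-- The double dual of the right `C`-module underlying a `(B, C)`-bimodule, with `B` acting through
double transposes. -/
def doubleDual (M : CentralBimodule K B C) : CentralBimodule K B C :=
  letI : Module B (DoubleDual C M) :=
    Module.compHom _ ((doubleTranspose C M).comp (Module.toModuleEnd Cᵐᵒᵖ (S := B) M))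
  { carrier := DoubleDual C M
    smulComm := ⟨fun _ _ _ => rfl⟩
    towerLeft := .mk fun k b x => LinearMap.ext fun f => by
      change x (f ∘ₗ Module.toModuleEnd Cᵐᵒᵖ (S := B) M (k • b)) =
        k • x (f ∘ₗ Module.toModuleEnd Cᵐᵒᵖ (S := B) M b)
      rw [← algebraMap_smul C k (x _), ← map_smul]
      refine congrArg x <| LinearMap.ext fun m => ?_
      change f ((k • b) • m) = algebraMap K C k * f (b • m)
      rw [smul_assoc, ← algebraMap_smul Cᵐᵒᵖ k (b • m), map_smul, MulOpposite.algebraMap_apply,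
        op_smul_eq_mul, Algebra.commutes] }

/-- The canonical map to the double dual, as a homomorphism of bimodules. -/
def evalHom (M : CentralBimodule K B C) : Hom M M.doubleDual :=
  ⟨doubleDualEval C M, fun _ _ => rfl⟩

end CentralBimodule

theorem GammaCondition.le_of_smul_mem (hγ : GammaCondition δ n 1 B C)
    (hδ : IsExactDimension δ Cᵐᵒᵖ) {L : CentralBimodule K B C} (hL : L.IsFG)
    {I : Submodule Bᵐᵒᵖ B} (hI : δ Bᵐᵒᵖ (B ⧸ I) ≤ n) {J : Submodule Cᵐᵒᵖ L} (hJ : δ Cᵐᵒᵖ J ≤ n)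
    (hIJ : ∀ b ∈ I, ∀ x : L, b • x ∈ J) : δ Cᵐᵒᵖ L ≤ n := by
  let μ := (CentralBimodule.Hom.lid L).toLin
  let p := rTensor Cᵐᵒᵖ L I.mkQ
  have hp : Function.Surjective p := map_surjective I.mkQ_surjective Function.surjective_id
  have hzero : (J.mkQ ∘ₗ μ) ∘ₗ rTensor Cᵐᵒᵖ L I.subtype = 0 :=
    linearMap_ext fun b x => (Submodule.Quotient.mk_eq_zero J).2 (hIJ b b.2 x)
  have hker : LinearMap.ker p ≤ LinearMap.ker (J.mkQ ∘ₗ μ) := fun t ht => by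
    obtain ⟨s, rfl⟩ := (map_exact (LinearMap.exact_subtype_mkQ I) I.mkQ_surjective t).1 ht
    exact LinearMap.congr_fun hzero s
  obtain ⟨k, hk⟩ := exists_comp_eq_of_ker_le_ker hp hker
  have hk_surjective : Function.Surjective k := by
    refine Function.Surjective.of_comp (g := p) ?_
    rw [← LinearMap.coe_comp, hk]
    exact J.mkQ_surjective.comp (CentralBimodule.Hom.lid_bijective L).2
  have hquot : δ Cᵐᵒᵖ (L ⧸ J) ≤ n := hδ.le_of_surjective hk_surjective (hγ.tensor_le hδ hL hI)
  exact hδ.le_of_ker_le_range J.subtype J.mkQ (by rw [J.ker_mkQ, J.range_subtype]) hJ hquot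

namespace CentralBimodule

/-- Bimodules finitely generated on both sides whose tensor products are the regular bimodules up
to modules of dimension at most `n`. -/
structure IsAlmostInverse (δ : DimFunction.{v, u} K) (n : EReal) (M : CentralBimodule K B C)
    (N : CentralBimodule K C B) : Prop where
  fg_left : M.IsFG
  fg_right : N.IsFG
  exists_left : ∃ e : Hom (M.tensor N) (regular K B), e.IsAlmostIso δ n
  exists_right : ∃ φ : Hom (N.tensor M) (regular K C), φ.IsAlmostIso δ n

variable {M P : CentralBimodule K B C} {N Q : CentralBimodule K C B}

theorem IsAlmostInverse.symm (h : IsAlmostInverse δ n M N) : IsAlmostInverse δ n N M :=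
  ⟨h.fg_right, h.fg_left, h.exists_right, h.exists_left⟩

theorem apply_tmul_eq_zero_of_mem_ker_evalHom (φ : Hom (N.tensor M) (regular K C)) {m : M}
    (hm : m ∈ LinearMap.ker M.evalHom.toLin) (x : N) : φ.toLin (tmul B x m) = 0 :=
  LinearMap.congr_fun hm (φ.toLin ∘ₗ mkRight Cᵐᵒᵖ x)

/- `M ⊗ N ⊗ M` maps to `M` both through `φ`, an almost isomorphism that kills `M ⊗ N ⊗ ker`, and
through `e`, whose image is almost all of `B`. So almost all of `B` sends `ker` into a small
submodule. -/
theorem IsAlmostInverse.ker_evalHom_le [IsNoetherianRing B] [IsNoetherianRing Cᵐᵒᵖ]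
    (hδ : IsExactDimension δ Cᵐᵒᵖ) (hγ : GammaCondition δ n 1 B C) (h : IsAlmostInverse δ n M N) :
    δ Cᵐᵒᵖ (LinearMap.ker M.evalHom.toLin) ≤ n := by
  have := h.fg_left.2
  obtain ⟨e, he⟩ := h.exists_left
  obtain ⟨φ, hφ⟩ := h.exists_right
  let L := M.ofSubmodule (LinearMap.ker M.evalHom.toLin) fun b m hm => by
    rw [LinearMap.mem_ker, M.evalHom.map_left, hm, smul_zero]
  let θ : Hom ((M.tensor N).tensor M) M := (Hom.rid M).comp ((φ.lTensor M).comp (Hom.assoc M N M))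
  have hθ : θ.IsAlmostIso δ n := .comp hδ (.of_bijective hδ (Hom.rid_bijective M))
    ((hφ.lTensor hδ M).comp hδ (.of_bijective hδ (Hom.assoc_bijective M N M)))
  have hθ_zero (t : M.tensor N) (m : L) : θ.toLin (tmul B t m.1) = 0 := by
    let θm := θ.toLin.toAddMonoidHom.comp (mkLeft (A := B) (M := M.tensor N) B m.1).toAddMonoidHom
    refine DFunLike.congr_fun (hom_ext C (φ := θm) (ψ := 0) fun m' x => ?_) t
    exact (congrArg (fun c : C => op c • m')
      (apply_tmul_eq_zero_of_mem_ker_evalHom φ m.2 x)).trans (zero_smul Cᵐᵒᵖ m')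
  let ρ : Hom ((M.tensor N).tensor M) M := (Hom.lid M).comp (e.rTensor M)
  let J := (LinearMap.ker θ.toLin).map ρ.toLin
  have hJ : δ Cᵐᵒᵖ (J.comap (LinearMap.ker M.evalHom.toLin).subtype) ≤ n := by
    refine hδ.le_of_injective (f := (LinearMap.ker M.evalHom.toLin).subtype.restrict
      (q := J) fun _ hm => hm) ?_ (hδ.submodule_map_le _ hθ.ker_le)
    exact fun x y hxy => Subtype.ext (Subtype.ext (congrArg (fun z : J => (z : M)) hxy))
  refine hγ.le_of_smul_mem hδ (h.fg_left.ofSubmodule _ _) (L := L) he.coker_le hJ ?_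
  rintro _ ⟨t, rfl⟩ m
  exact ⟨tmul B t m.1, hθ_zero t m, rfl⟩

theorem IsAlmostInverse.exists_projective_hull [IsNoetherianRing B] [IsNoetherianRing C]
    [IsNoetherianRing Cᵐᵒᵖ] {d : EReal} (hC : δ.alg C = d) (hd : d ≤ 2)
    (hδ : IsExactDimension δ C) (hδ' : IsExactDimension δ Cᵐᵒᵖ)
    (hγ : GammaCondition δ (d - 2) 1 B C) (hCM : IsDimCM δ C) (hAR : IsAuslanderRegular C)
    (h : IsAlmostInverse δ (d - 2) M N) :
    ∃ (P : CentralBimodule K B C) (η : Hom M P), Module.Finite Cᵐᵒᵖ P ∧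
      Module.Projective Cᵐᵒᵖ P ∧ η.IsAlmostIso δ (d - 2) := by
  subst hC
  have := h.fg_left.2
  exact ⟨M.doubleDual, M.evalHom, inferInstanceAs (Module.Finite Cᵐᵒᵖ (DoubleDual C M)),
    hCM.projective_dual hAR hδ hd _, h.ker_evalHom_le hδ' hγ,
    hCM.coker_doubleDualEval_le hAR hδ hδ' hd⟩

theorem exists_bijective_pairing [IsNoetherianRing Bᵐᵒᵖ] [IsNoetherianRing Cᵐᵒᵖ] {d : EReal}
    (hB : δ.alg B = d) (hδ : IsExactDimension δ Bᵐᵒᵖ) (hγ : GammaCondition δ (d - 2) 1 C B)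
    (hCM : IsDimCM δ B) [Module.Finite Cᵐᵒᵖ P] [Module.Finite Bᵐᵒᵖ Q] [Module.Projective Cᵐᵒᵖ P]
    [Module.Projective Bᵐᵒᵖ Q] {η : Hom M P} (hη : η.IsAlmostIso δ (d - 2)) {ψ : Hom N Q}
    (hψ : ψ.IsAlmostIso δ (d - 2)) (h : IsAlmostInverse δ (d - 2) M N) :
    ∃ k : Hom (P.tensor Q) (regular K B), Function.Bijective k.toLin := by
  subst hB
  have := h.fg_left.2
  have := h.fg_right.2
  obtain ⟨e, he⟩ := h.exists_left
  have hclosed := hCM.isClosedModule_self hδ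
  have : Module.Projective Bᵐᵒᵖ (P.tensor Q) :=
    projective_right (A := C) (M := P) (N := Q) (S := Bᵐᵒᵖ)
  have hηψ : ((ψ.lTensor P).comp (η.rTensor N)).IsAlmostIso δ (δ.alg B - 2) :=
    (hψ.lTensor hδ P).comp hδ (hη.rTensor hγ hδ h.fg_right)
  obtain ⟨k, hk⟩ := Hom.exists_extension_isAlmostIso (Z := regular K B) hδ hclosed hηψ he
  exact ⟨k, (hCM.isClosedModule_of_projective hδ).bijective_of_isAlmostIso hclosed hk⟩

theorem IsAlmostInverse.isMoritaEquivalent [IsNoetherianRing B] [IsNoetherianRing Bᵐᵒᵖ]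
    [IsNoetherianRing C] [IsNoetherianRing Cᵐᵒᵖ] {d : EReal} (hB : δ.alg B = d)
    (hC : δ.alg C = d) (hd : d ≤ 2) (hδB : IsExactDimension δ B) (hδB' : IsExactDimension δ Bᵐᵒᵖ)
    (hδC : IsExactDimension δ C) (hδC' : IsExactDimension δ Cᵐᵒᵖ)
    (hγBC : GammaCondition δ (d - 2) 1 B C) (hγCB : GammaCondition δ (d - 2) 1 C B)
    (hCMB : IsDimCM δ B) (hCMC : IsDimCM δ C) (hARB : IsAuslanderRegular B)
    (hARC : IsAuslanderRegular C) (h : IsAlmostInverse δ (d - 2) M N) :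
    IsMoritaEquivalent K B C := by
  obtain ⟨P, η, _, _, hη⟩ := h.exists_projective_hull hC hd hδC hδC' hγBC hCMC hARC
  obtain ⟨Q, ψ, _, _, hψ⟩ := h.symm.exists_projective_hull hB hd hδB hδB' hγCB hCMB hARB
  obtain ⟨k, hk⟩ := exists_bijective_pairing hB hδB' hγCB hCMB hη hψ h
  obtain ⟨l, hl⟩ := exists_bijective_pairing hC hδC' hγBC hCMC hψ hη h.symm
  exact isMoritaEquivalent_of_bijective k hk l hl

end CentralBimodule

end AlmostInverse

theorem theorem4p2_general {K : Type v} [CommRing K] (𝒜 : AlgebraClass.{v, u} K)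
    (δ : DimFunction.{v, u} K)
    (hδ : ∀ (A : Type u) [Ring A] [Algebra K A], 𝒜.Mem A → IsExactDimension δ A)
    (hδ' : ∀ (A : Type u) [Ring A] [Algebra K A], 𝒜.Mem A → IsExactDimension δ Aᵐᵒᵖ)
    (hγ : ∀ (A B : Type u) [Ring A] [Algebra K A] [Ring B] [Algebra K B],
      𝒜.Mem A → 𝒜.Mem B → δ.alg A = δ.alg B → GammaCondition δ (δ.alg A - 2) 1 A B)
    (A B₁ B₂ : Type u) [Ring A] [Algebra K A] [Ring B₁] [Algebra K B₁] [Ring B₂] [Algebra K B₂]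
    (hA : 𝒜.Mem A) (hdim : δ.alg A ≤ 2)
    (M₁ : CentralBimodule K B₁ A) (N₁ : CentralBimodule K A B₁) (h₁ : IsNQR 𝒜 δ A B₁ M₁ N₁)
    (M₂ : CentralBimodule K B₂ A) (N₂ : CentralBimodule K A B₂) (h₂ : IsNQR 𝒜 δ A B₂ M₂ N₂) :
    IsMoritaEquivalent K B₁ B₂ := by
  have := 𝒜.noetherian_right A hA
  have := 𝒜.noetherian_left B₁ h₁.mem
  have := 𝒜.noetherian_right B₁ h₁.mem
  have := 𝒜.noetherian_left B₂ h₂.mem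
  have := 𝒜.noetherian_right B₂ h₂.mem
  have hγ₁ := hγ A B₁ hA h₁.mem h₁.dim_eq.symm
  have hγ₂ := hγ A B₂ hA h₂.mem h₂.dim_eq.symm
  have hγ₁₂ := h₁.dim_eq ▸ hγ B₁ B₂ h₁.mem h₂.mem (h₁.dim_eq.trans h₂.dim_eq.symm)
  have hγ₂₁ := h₂.dim_eq ▸ hγ B₂ B₁ h₂.mem h₁.mem (h₂.dim_eq.trans h₁.dim_eq.symm)
  have hB₁ := h₁.dim_eq ▸ h₁.cohenMacaulay.isClosedModule_self (hδ' B₁ h₁.mem)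
  have hB₂ := h₂.dim_eq ▸ h₂.cohenMacaulay.isClosedModule_self (hδ' B₂ h₂.mem)
  have hinv : CentralBimodule.IsAlmostInverse δ (δ.alg A - 2) (M₁.tensor N₂) (M₂.tensor N₁) :=
    { fg_left := h₁.fg_left.tensor h₂.fg_right
      fg_right := h₂.fg_left.tensor h₁.fg_right
      exists_left := CentralBimodule.exists_pairing (hδ' A hA) (hδ' B₁ h₁.mem) hγ₁ hB₁
        h₁.fg_left h₁.fg_right h₂.fg_left h₂.fg_right h₁.iso_left h₂.iso_right
      exists_right := CentralBimodule.exists_pairing (hδ' A hA) (hδ' B₂ h₂.mem) hγ₂ hB₂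
        h₂.fg_left h₂.fg_right h₁.fg_left h₁.fg_right h₂.iso_left h₁.iso_right }
  exact hinv.isMoritaEquivalent h₁.dim_eq h₂.dim_eq hdim (hδ B₁ h₁.mem) (hδ' B₁ h₁.mem)
    (hδ B₂ h₂.mem) (hδ' B₂ h₂.mem) hγ₁₂ hγ₂₁ h₁.cohenMacaulay h₂.cohenMacaulay
    h₁.auslanderRegular h₂.auslanderRegular

theorem theorem4p2 {K : Type v} [CommRing K] (𝒜 : AlgebraClass.{v, u} K) (δ : DimFunction.{v, u} K)
    (h : StandingHypothesis 𝒜 δ)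
    (A B₁ B₂ : Type u) [Ring A] [Algebra K A] [Ring B₁] [Algebra K B₁] [Ring B₂] [Algebra K B₂]
    (hA : 𝒜.Mem A) (hdim : δ.alg A ≤ 2)
    (M₁ : CentralBimodule K B₁ A) (N₁ : CentralBimodule K A B₁) (h₁ : IsNQR 𝒜 δ A B₁ M₁ N₁)
    (M₂ : CentralBimodule K B₂ A) (N₂ : CentralBimodule K A B₂) (h₂ : IsNQR 𝒜 δ A B₂ M₂ N₂) :
    IsMoritaEquivalent K B₁ B₂ :=
  theorem4p2_general 𝒜 δ h.exact_left h.exact_right h.gamma A B₁ B₂ hA hdim M₁ N₁ h₁ M₂ N₂ h₂
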